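/- **Setting.** Write $z=(z_1,z_2)\in\mathbb R^2$, $(e_1,e_2)$ for the canonical basis, $\Gamma=\{z_1=0\}$, $\Omega^L=\{z_1<0\}$, $\Omega^R=\{z_1>0\}$, $\sigma^L=-1$, $\sigma^R=1$. Let $g:\mathbb R\to\mathbb R$ be $C^2$ and $1$-periodic, $\lambda>0$, and $\Gamma_\epsilon=\{x_1=\epsilon g(x_2/\epsilon)\}$ for $\epsilon>0$. Let $A^L,A^R$ be disjoint nonempty compact subsets of a metric space and, for $i=L,R$, let $f^i:\mathbb R^2\times A^i\to\mathbb R^2$ and $\ell^i:\mathbb R^2\times A^i\to\mathbb R$ be bounded and continuous, such that, uniformly in $a\in A^i$, $f^i(\cdot,a)$ is Lipschitz and $\ell^i(\cdot,a)$ has a modulus of continuity; the sets $\{(f^i(x,a),\ell^i(x,a)):a\in A^i\}$ are closed and convex for all $x\in\mathbb R^2$; and there is $\delta_0>0$ such that $B(0,\delta_0)\subset\{f^i(x,a):a\in A^i\}$ for all $\epsilon>0$, $x\in\Gamma_\epsilon$ and $i=L,R$. **Hamiltonians.** Put $H^i(x,p)=\max_{a\in A^i}(-p\cdot f^i(x,a)-\ell^i(x,a))$;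 $H^{\pm,i}(x,p)$ is the same maximum restricted to the $a\in A^i$ with $\pm\sigma^i f^i(x,a)\cdot e_1\ge 0$; and $H_\Gamma(z,p^L,p^R)=\max(H^{+,L}(z,p^L),H^{+,R}(z,p^R))$. Let $\tilde H^i(z,p,y_2)$ and $\tilde H^{\pm,i}(z,p,y_2)$ be defined in the same way as $H^i(z,p)$ and $H^{\pm,i}(z,p)$, with $f^i(z,a)$ replaced by $\tilde J(y_2)f^i(z,a)$, where $\tilde J(y_2)=\begin{pmatrix}1&-g'(y_2)\\0&1\end{pmatrix}$. **Test functions.** $\mathcal R$ is the set of continuous $\phi:\mathbb R^2\to\mathbb R$ whose restrictions to $\overline{\Omega^L}$ and $\overline{\Omega^R}$ are $C^1$; $D\phi^i$ denotes the gradient from the side $\overline{\Omega^i}$. **Effective tangential Hamiltonian.** For $\rho>0$, $\lambda_\rho(z_2,p_2)$ is the unique real number such that the problem on $[-\rho,\rho]\times\mathbb R$ $$\begin{cases}\tilde H^L((0,z_2),Du+p_2e_2,y_2)=\lambda_\rho,&-\rho<y_1<0,\\ \tilde H^R((0,z_2),Du+p_2e_2,y_2)=\lambda_\rho,&0<y_1<\rho,\\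 \max_{i=L,R}\tilde H^{+,i}((0,z_2),Du^i+p_2e_2,y_2)=\lambda_\rho,&y_1=0,\\ \tilde H^{-,L}((0,z_2),Du+p_2e_2,y_2)=\lambda_\rho,&y_1=-\rho,\\ \tilde H^{-,R}((0,z_2),Du+p_2e_2,y_2)=\lambda_\rho,&y_1=\rho,\end{cases}$$ has a bounded continuous viscosity solution that is $1$-periodic in $y_2$ (test functions: restrictions of elements of $\mathcal R$, local extrema relative to the closed strip). Put $E(z_2,p_2)=\lim_{\rho\to\infty}\lambda_\rho(z_2,p_2)$. **Critical slopes.** Let $S^i(z_2,p_2)=\{p\in\mathbb R: H^i((0,z_2),p_2e_2+pe_1)=H^{-,i}((0,z_2),p_2e_2+pe_1)=E(z_2,p_2)\}$, $\overline\Pi^L=\max S^L$, $\widehat\Pi^L=\min S^L$, $\overline\Pi^R=\min S^R$, $\widehat\Pi^R=\max S^R$. Let $\Pi=(\Pi^L,\Pi^R):\mathbb R^2\to\mathbb R^2$ be any map with $\widehat\Pi^L\le\Pi^L\le\overline\Pi^L$ and $\overline\Pi^R\le\Pi^R\le\widehat\Pi^R$ on $\mathbb R^2$. For $\bar z=(0,\bar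 z_2)\in\Gamma$, let $\mathcal R^\Pi(\bar z)$ be the set of the functions $$\varphi(z)=\psi(z_2)+\bigl(\Pi^R(\bar z_2,\psi'(\bar z_2))\mathbf 1_{\Omega^R}(z)+\Pi^L(\bar z_2,\psi'(\bar z_2))\mathbf 1_{\Omega^L}(z)\bigr)z_1,\qquad \psi\in C^1(\mathbb R).$$ **Viscosity notions.** Consider the equations $$(1)\quad \lambda u+H^i(z,Du)=0\ \text{ in }\Omega^i,\ i=L,R,$$ $$(2)\quad \lambda u+\max\bigl(E(z_2,\partial_{z_2}u),H_\Gamma(z,Du^L,Du^R)\bigr)=0\ \text{ on }\Gamma.$$ A subsolution (supersolution) of (1) or (2) is an upper (lower) semicontinuous $u:\mathbb R^2\to\mathbb R$ such that the inequality $\le0$ ($\ge0$) holds in (1) at each $z\in\Omega^i$, respectively in (2) at each $z\in\Gamma$, with the derivatives of $u$ replaced by those of $\phi$, for each $\phi\in\mathcal R$ such that $u-\phi$ has a local maximum (minimum) at $z$. **Theorem.** Let $\Pi$ be as above. (i) Let $u$ be a subsolution of (1). If $u$ is a subsolution of (2), then for all $z\in\Gamma$ and all $\varphi\in\mathcal R^\Pi(z)$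 such that $u-\varphi$ has a local maximum at $z$, $$(3)\quad \lambda u(z)+\max\bigl(E(z_2,\partial_{z_2}\varphi(z)),H_\Gamma(z,D\varphi^L(z),D\varphi^R(z))\bigr)\le0 .$$ Conversely, if (3) holds for all such $z,\varphi$, and if $u(z)=\limsup_{\Omega^i\ni z'\to z}u(z')$ for all $z\in\Gamma$ and $i=L,R$, then $u$ is a subsolution of (2). (ii) Let $u$ be a supersolution of (1). Then $u$ is a supersolution of (2) if and only if for all $z\in\Gamma$ and all $\varphi\in\mathcal R^\Pi(z)$ such that $u-\varphi$ has a local minimum at $z$, $$\lambda u(z)+\max\bigl(E(z_2,\partial_{z_2}\varphi(z)),H_\Gamma(z,D\varphi^L(z),D\varphi^R(z))\bigr)\ge0 .$$ -/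

import Mathlib

open Filter Topology

namespace Interface

noncomputable section

/-- The Euclidean plane; coordinate `0` is the first one (normal to the interface), coordinate `1`
the second one (along the interface). -/
abbrev Plane : Type := EuclideanSpace ℝ (Fin 2)

/-- The index set `{L, R}`. -/
inductive Side : Type where
  | L : Side
  | R : Side

/-- `σ^L = -1`, `σ^R = 1`. -/
def Side.sign : Side → ℝ
  | Side.L => -1
  | Side.R => 1

/-- The open half-plane `Ω^i`: `z₁ < 0` for `i = L`, `z₁ > 0` for `i = R`. -/
def halfPlane (i : Side) : Set Plane := {z | 0 < i.sign * z 0}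

/-- The closed half-plane `Ω̄^i`. -/
def closedHalfPlane (i : Side) : Set Plane := {z | 0 ≤ i.sign * z 0}

/-- The straight interface `Γ = {z₁ = 0}`. -/
def interface : Set Plane := {z | z 0 = 0}

/-- The oscillating interface `Γ_ε = {x₁ = ε g (x₂ / ε)}`. -/
def oscInterface (g : ℝ → ℝ) (ε : ℝ) : Set Plane := {x | x 0 = ε * g (x 1 / ε)}

/-- The data: the control sets `A^i`, the dynamics `f^i`, the running costs `ℓ^i` (only their values
on `ℝ² × A^i` matter), the profile `g` of the interface and the discount rate `λ`. -/
structure ControlData (A : Type*) where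
  ctrl : Side → Set A
  f : Side → Plane → A → Plane
  cost : Side → Plane → A → ℝ
  g : ℝ → ℝ
  discount : ℝ

/-- The standing assumptions on the data (regularity of the profile `g`, `λ > 0`, [H0]-[H3]). -/
structure ControlData.StandingAssumptions {A : Type*} [MetricSpace A] (D : ControlData A) :
    Prop where
  g_smooth : ContDiff ℝ 2 D.g
  g_periodic : Function.Periodic D.g 1
  discount_pos : 0 < D.discount
  ctrl_nonempty : ∀ i, (D.ctrl i).Nonempty
  ctrl_compact : ∀ i, IsCompact (D.ctrl i)
  ctrl_disjoint : Disjoint (D.ctrl Side.L) (D.ctrl Side.R)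
  f_continuous : ∀ i, ContinuousOn (fun q : Plane × A => D.f i q.1 q.2) (Set.univ ×ˢ D.ctrl i)
  f_bounded : ∃ M : ℝ, ∀ i x, ∀ a ∈ D.ctrl i, ‖D.f i x a‖ ≤ M
  f_lipschitz : ∃ K : ℝ, 0 < K ∧
    ∀ i x y, ∀ a ∈ D.ctrl i, ‖D.f i x a - D.f i y a‖ ≤ K * ‖x - y‖
  cost_continuous : ∀ i,
    ContinuousOn (fun q : Plane × A => D.cost i q.1 q.2) (Set.univ ×ˢ D.ctrl i)
  cost_bounded : ∃ M : ℝ, ∀ i x, ∀ a ∈ D.ctrl i, |D.cost i x a| ≤ M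
  cost_modulus : ∃ ω : ℝ → ℝ, Tendsto ω (𝓝[≥] 0) (𝓝 0) ∧
    ∀ i x y, ∀ a ∈ D.ctrl i, |D.cost i x a - D.cost i y a| ≤ ω ‖x - y‖
  closed_convex : ∀ i x,
    IsClosed ((fun a => (D.f i x a, D.cost i x a)) '' D.ctrl i) ∧
    Convex ℝ ((fun a => (D.f i x a, D.cost i x a)) '' D.ctrl i)
  controllable : ∃ δ : ℝ, 0 < δ ∧ ∀ ε : ℝ, 0 < ε → ∀ i, ∀ x ∈ oscInterface D.g ε,
    Metric.ball (0 : Plane) δ ⊆ (fun a => D.f i x a) '' D.ctrl i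

/-- `max_{a ∈ S} (-p · F(a) - l(a))`. -/
def controlHam {A : Type*} (F : A → Plane) (l : A → ℝ) (S : Set A) (p : Plane) : ℝ :=
  sSup ((fun a => -(inner ℝ p (F a)) - l a) '' S)

/-- Admissible test functions: continuous on `ℝ²`, and of class `C¹` on each closed half-plane. -/
def IsTestFunction (φ : Plane → ℝ) : Prop :=
  Continuous φ ∧ ∀ i, ContDiffOn ℝ 1 φ (closedHalfPlane i)

/-- `Dφ^i(x)`, the gradient at `x ∈ Ω̄^i` of the restriction of `φ` to `Ω̄^i`. It is the usual
gradient in `Ω^i`, and the limit of `Dφ(x')` as `x' → x`, `x' ∈ Ω^i`, if `x` is on `Γ`. -/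
def sideGrad (φ : Plane → ℝ) (i : Side) (x : Plane) : Plane :=
  gradientWithin φ (closedHalfPlane i) x

/-- `∂_{z₂} φ(z)`. -/
def tangentialDeriv (φ : Plane → ℝ) (z : Plane) : ℝ :=
  deriv (fun t : ℝ => φ !₂[z 0, t]) (z 1)

/-- The matrix `J̃(y₂) = [[1, -g'(y₂)], [0, 1]]` applied to a vector. -/
def shear (g : ℝ → ℝ) (y₂ : ℝ) (v : Plane) : Plane := !₂[v 0 - deriv g y₂ * v 1, v 1]

/-- The closed strip `[-ρ, ρ] × ℝ`. -/
def strip (ρ : ℝ) : Set Plane := {y | |y 0| ≤ ρ}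

namespace ControlData

variable {A : Type*} (D : ControlData A)

/-- `H^i(x, p)`. -/
def H (i : Side) (x p : Plane) : ℝ :=
  controlHam (D.f i x) (D.cost i x) (D.ctrl i) p

/-- `H^{+,i}(x, p)`: only the dynamics pointing towards `Ω^i` (or tangent to `Γ`). -/
def Hplus (i : Side) (x p : Plane) : ℝ :=
  controlHam (D.f i x) (D.cost i x) {a ∈ D.ctrl i | 0 ≤ i.sign * D.f i x a 0} p

/-- `H^{-,i}(x, p)`: only the dynamics pointing out of `Ω^i` (or tangent to `Γ`). -/
def Hminus (i : Side) (x p : Plane) : ℝ :=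
  controlHam (D.f i x) (D.cost i x) {a ∈ D.ctrl i | 0 ≤ -(i.sign * D.f i x a 0)} p

/-- `H_Γ(z, p^L, p^R)`. -/
def Hinterface (z pL pR : Plane) : ℝ :=
  max (D.Hplus Side.L z pL) (D.Hplus Side.R z pR)

/-- `E_0^i(z₂, p₂) = min_q H^i((0, z₂), p₂ e₂ + q e₁)`. -/
def E₀side (i : Side) (z₂ p₂ : ℝ) : ℝ :=
  sInf (Set.range fun q : ℝ => D.H i !₂[0, z₂] !₂[q, p₂])

/-- `E_0 = max (E_0^L, E_0^R)`. -/
def E₀ (z₂ p₂ : ℝ) : ℝ := max (D.E₀side Side.L z₂ p₂) (D.E₀side Side.R z₂ p₂)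

/-- `H̃^i(z, p, y₂)`, with the dynamics `J̃(y₂) f^i(z, a)`. -/
def Ht (i : Side) (z p : Plane) (y₂ : ℝ) : ℝ :=
  controlHam (fun a => shear D.g y₂ (D.f i z a)) (D.cost i z) (D.ctrl i) p

/-- `H̃^{+,i}(z, p, y₂)`. -/
def HtPlus (i : Side) (z p : Plane) (y₂ : ℝ) : ℝ :=
  controlHam (fun a => shear D.g y₂ (D.f i z a)) (D.cost i z)
    {a ∈ D.ctrl i | 0 ≤ i.sign * shear D.g y₂ (D.f i z a) 0} p

/-- `H̃^{-,i}(z, p, y₂)`. -/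
def HtMinus (i : Side) (z p : Plane) (y₂ : ℝ) : ℝ :=
  controlHam (fun a => shear D.g y₂ (D.f i z a)) (D.cost i z)
    {a ∈ D.ctrl i | 0 ≤ -(i.sign * shear D.g y₂ (D.f i z a) 0)} p

/-- The Hamiltonian of the truncated cell problem on `[-ρ, ρ] × ℝ`, evaluated at the point `y` of
the strip and at a test function `φ`: `H̃^i` for `0 < |y₁| < ρ`, `max_i H̃^{+,i}` on `Γ`, and
`H̃^{-,i}` (state constraint) on the two sides `y₁ = ±ρ`. -/
def cellHam (ρ z₂ p₂ : ℝ) (φ : Plane → ℝ) (y : Plane) : ℝ :=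
  if y 0 = 0 then
    max (D.HtPlus Side.L !₂[0, z₂] (sideGrad φ Side.L y + !₂[0, p₂]) (y 1))
      (D.HtPlus Side.R !₂[0, z₂] (sideGrad φ Side.R y + !₂[0, p₂]) (y 1))
  else if y 0 = -ρ then D.HtMinus Side.L !₂[0, z₂] (sideGrad φ Side.L y + !₂[0, p₂]) (y 1)
  else if y 0 = ρ then D.HtMinus Side.R !₂[0, z₂] (sideGrad φ Side.R y + !₂[0, p₂]) (y 1)
  else if y 0 < 0 then D.Ht Side.L !₂[0, z₂] (sideGrad φ Side.L y + !₂[0, p₂]) (y 1)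
  else D.Ht Side.R !₂[0, z₂] (sideGrad φ Side.R y + !₂[0, p₂]) (y 1)

/-- `u` is a (continuous) viscosity solution, `1`-periodic in `y₂`, of the truncated cell problem on
`[-ρ, ρ] × ℝ` with right-hand side `μ`. Only the values of `u` on the strip matter. -/
structure IsCellSolution (ρ z₂ p₂ μ : ℝ) (u : Plane → ℝ) : Prop where
  continuousOn : ContinuousOn u (strip ρ)
  periodic : ∀ y ∈ strip ρ, u (y + !₂[0, 1]) = u y
  sub : ∀ y ∈ strip ρ, ∀ φ, IsTestFunction φ → IsLocalMaxOn (fun x => u x - φ x) (strip ρ) y →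
    D.cellHam ρ z₂ p₂ φ y ≤ μ
  super : ∀ y ∈ strip ρ, ∀ φ, IsTestFunction φ → IsLocalMinOn (fun x => u x - φ x) (strip ρ) y →
    μ ≤ D.cellHam ρ z₂ p₂ φ y

/-- `μ` is the ergodic constant `λ_ρ(z₂, p₂)`: the truncated cell problem with right-hand side `μ`
admits a bounded viscosity solution. -/
def IsErgodicConstant (ρ z₂ p₂ μ : ℝ) : Prop :=
  ∃ u : Plane → ℝ, (∃ C : ℝ, ∀ y ∈ strip ρ, |u y| ≤ C) ∧ D.IsCellSolution ρ z₂ p₂ μ u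

/-- `e = lim_{ρ → ∞} λ_ρ(z₂, p₂)`. -/
def IsEffectiveValue (z₂ p₂ e : ℝ) : Prop :=
  ∃ μ : ℝ → ℝ, (∀ ρ, 0 < ρ → D.IsErgodicConstant ρ z₂ p₂ (μ ρ)) ∧ Tendsto μ atTop (𝓝 e)

open Classical in
/-- The effective tangential Hamiltonian `E(z₂, p₂) = lim_{ρ → ∞} λ_ρ(z₂, p₂)`. Under the standing
assumptions, the constants `λ_ρ` exist, are unique, and have a finite limit, so that the value in
the second branch is only a convention for data that violate these assumptions. -/
def E (z₂ p₂ : ℝ) : ℝ :=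
  if h : ∃ e, D.IsEffectiveValue z₂ p₂ e then h.choose else D.E₀ z₂ p₂

/-- `{p : H^i((0, z₂), p₂ e₂ + p e₁) = H^{-,i}((0, z₂), p₂ e₂ + p e₁) = E(z₂, p₂)}`. -/
def criticalSlopes (i : Side) (z₂ p₂ : ℝ) : Set ℝ :=
  {p | D.H i !₂[0, z₂] !₂[p, p₂] = D.Hminus i !₂[0, z₂] !₂[p, p₂] ∧
    D.Hminus i !₂[0, z₂] !₂[p, p₂] = D.E z₂ p₂}

/-- `Π̄^L` is the maximum, and `Π̄^R` the minimum, of the critical slopes. -/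
def PiBar : Side → ℝ → ℝ → ℝ
  | Side.L, z₂, p₂ => sSup (D.criticalSlopes Side.L z₂ p₂)
  | Side.R, z₂, p₂ => sInf (D.criticalSlopes Side.R z₂ p₂)

/-- `Π̂^L` is the minimum, and `Π̂^R` the maximum, of the critical slopes. -/
def PiHat : Side → ℝ → ℝ → ℝ
  | Side.L, z₂, p₂ => sInf (D.criticalSlopes Side.L z₂ p₂)
  | Side.R, z₂, p₂ => sSup (D.criticalSlopes Side.R z₂ p₂)

/-- `Π = (Π^L, Π^R)` is a selection between the critical slopes:
`Π̂^L ≤ Π^L ≤ Π̄^L` and `Π̄^R ≤ Π^R ≤ Π̂^R`. -/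
def IsSlopeSelection (P : Side → ℝ → ℝ → ℝ) : Prop :=
  ∀ z₂ p₂ : ℝ,
    (D.PiHat Side.L z₂ p₂ ≤ P Side.L z₂ p₂ ∧ P Side.L z₂ p₂ ≤ D.PiBar Side.L z₂ p₂) ∧
    (D.PiBar Side.R z₂ p₂ ≤ P Side.R z₂ p₂ ∧ P Side.R z₂ p₂ ≤ D.PiHat Side.R z₂ p₂)

/-- `λ u(z) + max (E(z₂, ∂_{z₂} φ(z)), H_Γ(z, Dφ^L(z), Dφ^R(z)))`. -/
def transmission (u φ : Plane → ℝ) (z : Plane) : ℝ :=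
  D.discount * u z + max (D.E (z 1) (tangentialDeriv φ z))
    (D.Hinterface z (sideGrad φ Side.L z) (sideGrad φ Side.R z))

/-- `u` is a subsolution of `λ u + H^i(z, Du) = 0` in `Ω^i`, `i = L, R`. -/
def IsSubsolutionOff (u : Plane → ℝ) : Prop :=
  UpperSemicontinuous u ∧ ∀ i, ∀ z ∈ halfPlane i, ∀ φ, IsTestFunction φ →
    IsLocalMax (fun x => u x - φ x) z → D.discount * u z + D.H i z (sideGrad φ i z) ≤ 0

/-- `u` is a supersolution of `λ u + H^i(z, Du) = 0` in `Ω^i`, `i = L, R`. -/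
def IsSupersolutionOff (u : Plane → ℝ) : Prop :=
  LowerSemicontinuous u ∧ ∀ i, ∀ z ∈ halfPlane i, ∀ φ, IsTestFunction φ →
    IsLocalMin (fun x => u x - φ x) z → 0 ≤ D.discount * u z + D.H i z (sideGrad φ i z)

/-- `u` is a subsolution of the effective transmission condition on `Γ`. -/
def IsSubsolutionOn (u : Plane → ℝ) : Prop :=
  UpperSemicontinuous u ∧ ∀ z ∈ interface, ∀ φ, IsTestFunction φ →
    IsLocalMax (fun x => u x - φ x) z → D.transmission u φ z ≤ 0

/-- `u` is a supersolution of the effective transmission condition on `Γ`. -/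
def IsSupersolutionOn (u : Plane → ℝ) : Prop :=
  LowerSemicontinuous u ∧ ∀ z ∈ interface, ∀ φ, IsTestFunction φ →
    IsLocalMin (fun x => u x - φ x) z → 0 ≤ D.transmission u φ z

end ControlData

/-- The reduced set `R^Π(z̄)` of test functions, `z̄ = (0, z̄₂)`: the continuous functions
`z ↦ ψ(z₂) + (Π^R(z̄₂, ψ'(z̄₂)) 1_{Ω^R}(z) + Π^L(z̄₂, ψ'(z̄₂)) 1_{Ω^L}(z)) z₁`, `ψ` of class `C¹`. -/
def reducedTestFunctions (P : Side → ℝ → ℝ → ℝ) (zbar : Plane) : Set (Plane → ℝ) :=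
  {φ | Continuous φ ∧ ∃ ψ : ℝ → ℝ, ContDiff ℝ 1 ψ ∧ ∀ z : Plane,
    φ z = ψ (z 1) +
      ((halfPlane Side.R).indicator (fun _ => P Side.R (zbar 1) (deriv ψ (zbar 1))) z +
        (halfPlane Side.L).indicator (fun _ => P Side.L (zbar 1) (deriv ψ (zbar 1))) z) * z 0}

/-- `u(z) ≤ limsup_{Ω^i ∋ z' → z} u(z')` for each `z ∈ Γ` and each `i = L, R` (for an upper
semicontinuous `u` this is an equality): `u` does not jump up on `Γ`. -/
def NoJumpOnInterface (u : Plane → ℝ) : Prop :=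
  ∀ i, ∀ z ∈ interface, ∀ c < u z, ∃ᶠ z' in 𝓝[halfPlane i] z, c < u z'

end

end Interface

namespace Interface

/-! On each side the normal slope is measured by `s = σ^i p`, the rate of growth away from `Γ`. In
this coordinate `H^{+,i}` is nonincreasing, `H^{-,i}` is nondecreasing, and `H^i` is their maximum
on `Γ`. The only fact needed about `E` is that it is at least the minimum of `H^i` over `s`
(`exists_tangential_control`, `le_E`). Hence the critical slopes form a nonempty compact set, and
any admissible `Π` has three properties: `H^{-,i} ≥ E` from `Π^i` on, `H^{-,i} ≤ E` up to `Π^i`, and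
`H^{+,i} ≤ E` at `Π^i`.

Reduced functions are test functions, so only the reverse implications have content. Let `φ` touch
`u` at `z ∈ Γ` and let `ψ` be its trace on `Γ`. Either the reduced function built on `ψ` also
touches `u` at `z`, or on some side the slope `Π^i` fails to touch. In the latter case there is a
limiting slope `c` between touching and not touching, and the equation in `Ω^i` holds at `z` with
normal slope `c` (`le_zero_of_critical_slope`).

For a subsolution, `c` lies beyond `Π^i`, so `λu + E ≤ λu + H^i ≤ 0` there; if instead the reduced
function touches, the hypothesis gives the same bound. The `H_Γ` part comes separately from the
equations in `Ω^i`: the dynamics entering `Ω^i` carry the inequality to `Γ` when `u` does not jump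
(`Hplus_le_zero`).

For a supersolution, suppose the condition fails at `φ`. A limiting slope would lie between that of
`φ` and `Π^i`, where `H^{+,i}` is controlled by its value at `φ` and `H^{-,i}` by `E`, contradicting
the equation. So the reduced function touches, and since `H^{+,i} ≤ E` at `Π^i` its condition reads
`λu + E ≥ 0`, again a contradiction. -/

lemma inner_plane (p v : Plane) : inner ℝ p v = p 0 * v 0 + p 1 * v 1 := by
  simp [PiLp.inner_apply, Fin.sum_univ_two, mul_comm]

lemma plane_ext {p q : Plane} (h0 : p 0 = q 0) (h1 : p 1 = q 1) : p = q := by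
  ext j; fin_cases j
  · exact h0
  · exact h1

lemma Side.sign_mul_self (i : Side) : i.sign * i.sign = 1 := by cases i <;> simp [Side.sign]

lemma Side.abs_sign (i : Side) : |i.sign| = 1 := by cases i <;> simp [Side.sign]

lemma Side.sign_mul_sign_mul (i : Side) (t : ℝ) : i.sign * (i.sign * t) = t := by
  rw [← mul_assoc, i.sign_mul_self, one_mul]

lemma Side.abs_sign_mul (i : Side) (t : ℝ) : |i.sign * t| = |t| := by
  rw [abs_mul, i.abs_sign, one_mul]

/-! ### Maxima of affine functions of the momentum over a control set. -/

section ControlHam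

variable {A : Type*} {F F' : A → Plane} {l l' : A → ℝ} {S : Set A} {p q : Plane}

lemma bddAbove_controlHam {M M' : ℝ} (hF : ∀ a ∈ S, ‖F a‖ ≤ M) (hl : ∀ a ∈ S, |l a| ≤ M')
    (p : Plane) : BddAbove ((fun a => -(inner ℝ p (F a)) - l a) '' S) := by
  refine ⟨‖p‖ * M + M', ?_⟩
  rintro _ ⟨a, ha, rfl⟩
  have h1 := abs_real_inner_le_norm p (F a)
  have h2 : ‖p‖ * ‖F a‖ ≤ ‖p‖ * M := mul_le_mul_of_nonneg_left (hF a ha) (norm_nonneg _)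
  have h3 := neg_abs_le (inner ℝ p (F a))
  have h4 := neg_abs_le (l a)
  have h5 := hl a ha
  simp only
  linarith

lemma le_controlHam (hb : BddAbove ((fun a => -(inner ℝ p (F a)) - l a) '' S)) {a : A}
    (ha : a ∈ S) : -(inner ℝ p (F a)) - l a ≤ controlHam F l S p :=
  le_csSup hb ⟨a, ha, rfl⟩

lemma controlHam_le (hS : S.Nonempty) {c : ℝ} (h : ∀ a ∈ S, -(inner ℝ p (F a)) - l a ≤ c) :
    controlHam F l S p ≤ c := by
  refine csSup_le (hS.image _) ?_
  rintro _ ⟨a, ha, rfl⟩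
  exact h a ha

lemma abs_controlHam_sub_le (hS : S.Nonempty)
    (hb : BddAbove ((fun a => -(inner ℝ p (F a)) - l a) '' S))
    (hb' : BddAbove ((fun a => -(inner ℝ q (F' a)) - l' a) '' S)) {c : ℝ}
    (h : ∀ a ∈ S, |(-(inner ℝ p (F a)) - l a) - (-(inner ℝ q (F' a)) - l' a)| ≤ c) :
    |controlHam F l S p - controlHam F' l' S q| ≤ c := by
  have h1 : controlHam F l S p ≤ controlHam F' l' S q + c := controlHam_le hS fun a ha => by
    have := (abs_le.1 (h a ha)).2
    have := le_controlHam hb' ha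
    linarith
  have h2 : controlHam F' l' S q ≤ controlHam F l S p + c := controlHam_le hS fun a ha => by
    have := (abs_le.1 (h a ha)).1
    have := le_controlHam hb ha
    linarith
  rw [abs_le]; constructor <;> linarith

lemma continuous_controlHam (hS : S.Nonempty) {M M' : ℝ} (hF : ∀ a ∈ S, ‖F a‖ ≤ M)
    (hl : ∀ a ∈ S, |l a| ≤ M') : Continuous (controlHam F l S) := by
  refine continuous_iff_continuousAt.2 fun q => ?_
  have hlim : Tendsto (fun p : Plane => ‖p - q‖ * M) (𝓝 q) (𝓝 0) := by
    have : Continuous (fun p : Plane => ‖p - q‖ * M) := by fun_prop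
    simpa using this.tendsto q
  rw [ContinuousAt, tendsto_iff_dist_tendsto_zero]
  refine squeeze_zero (fun _ => dist_nonneg) (fun p => ?_) hlim
  rw [Real.dist_eq]
  refine abs_controlHam_sub_le hS (bddAbove_controlHam hF hl _) (bddAbove_controlHam hF hl _)
    fun a ha => ?_
  have e : (-(inner ℝ p (F a)) - l a) - (-(inner ℝ q (F a)) - l a) = -inner ℝ (p - q) (F a) := by
    rw [inner_sub_left]; ring
  rw [e, abs_neg]
  exact (abs_real_inner_le_norm _ _).trans (mul_le_mul_of_nonneg_left (hF a ha) (norm_nonneg _))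

lemma exists_controlHam_eq [TopologicalSpace A] (hS : S.Nonempty) (hc : IsCompact S)
    (hF : ContinuousOn F S) (hl : ContinuousOn l S) (p : Plane) :
    ∃ a ∈ S, controlHam F l S p = -(inner ℝ p (F a)) - l a := by
  have hcont : ContinuousOn (fun a => -(inner ℝ p (F a)) - l a) S :=
    ((continuousOn_const.inner hF).neg).sub hl
  obtain ⟨a, ha, hmax⟩ := hc.exists_isMaxOn hS hcont
  refine ⟨a, ha, le_antisymm (controlHam_le hS fun b hb => hmax hb) ?_⟩
  exact le_controlHam (hc.bddAbove_image hcont) ha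

end ControlHam

/-! ### The Hamiltonians and controllability on the straight interface. -/

namespace ControlData

namespace StandingAssumptions

variable {A : Type*} [MetricSpace A] {D : ControlData A} (hD : D.StandingAssumptions)
include hD

lemma continuousOn_f (i : Side) (x : Plane) : ContinuousOn (D.f i x) (D.ctrl i) :=
  (hD.f_continuous i).comp (f := fun a => (x, a)) (by fun_prop) fun _ ha => ⟨trivial, ha⟩

lemma continuousOn_cost (i : Side) (x : Plane) : ContinuousOn (D.cost i x) (D.ctrl i) :=
  (hD.cost_continuous i).comp (f := fun a => (x, a)) (by fun_prop) fun _ ha => ⟨trivial, ha⟩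

lemma continuous_f_left (i : Side) {a : A} (ha : a ∈ D.ctrl i) :
    Continuous fun x => D.f i x a := by
  rw [← continuousOn_univ]
  exact (hD.f_continuous i).comp (f := fun x => (x, a)) (by fun_prop) fun _ _ => ⟨trivial, ha⟩

lemma continuous_cost_left (i : Side) {a : A} (ha : a ∈ D.ctrl i) :
    Continuous fun x => D.cost i x a := by
  rw [← continuousOn_univ]
  exact (hD.cost_continuous i).comp (f := fun x => (x, a)) (by fun_prop) fun _ _ => ⟨trivial, ha⟩

lemma bddAbove_image (i : Side) (x : Plane) {S : Set A} (hS : S ⊆ D.ctrl i) (p : Plane) :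
    BddAbove ((fun a => -(inner ℝ p (D.f i x a)) - D.cost i x a) '' S) := by
  obtain ⟨M, hM⟩ := hD.f_bounded
  obtain ⟨M', hM'⟩ := hD.cost_bounded
  exact bddAbove_controlHam (fun a ha => hM i x a (hS ha)) (fun a ha => hM' i x a (hS ha)) p

lemma le_H (i : Side) (x p : Plane) {a : A} (ha : a ∈ D.ctrl i) :
    -(inner ℝ p (D.f i x a)) - D.cost i x a ≤ D.H i x p :=
  le_controlHam (hD.bddAbove_image i x subset_rfl p) ha

lemma le_Hplus (i : Side) (x p : Plane) {a : A} (ha : a ∈ D.ctrl i)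
    (h : 0 ≤ i.sign * D.f i x a 0) :
    -(inner ℝ p (D.f i x a)) - D.cost i x a ≤ D.Hplus i x p :=
  le_controlHam (hD.bddAbove_image i x (fun _ h => h.1) p) ⟨ha, h⟩

lemma le_Hminus (i : Side) (x p : Plane) {a : A} (ha : a ∈ D.ctrl i)
    (h : 0 ≤ -(i.sign * D.f i x a 0)) :
    -(inner ℝ p (D.f i x a)) - D.cost i x a ≤ D.Hminus i x p :=
  le_controlHam (hD.bddAbove_image i x (fun _ h => h.1) p) ⟨ha, h⟩

/-- The Hamiltonian is continuous in both variables. -/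
lemma continuous_H (i : Side) : Continuous fun q : Plane × Plane => D.H i q.1 q.2 := by
  obtain ⟨M, hM⟩ := hD.f_bounded
  obtain ⟨K, hK, hKf⟩ := hD.f_lipschitz
  obtain ⟨ω, hω, hωl⟩ := hD.cost_modulus
  refine continuous_iff_continuousAt.2 fun ⟨z, q⟩ => ?_
  have hlim : Tendsto (fun r : Plane × Plane =>
      ‖r.2‖ * (K * ‖r.1 - z‖) + ‖r.2 - q‖ * M + ω ‖r.1 - z‖) (𝓝 (z, q)) (𝓝 0) := by
    have c1 : Continuous (fun r : Plane × Plane => ‖r.2‖ * (K * ‖r.1 - z‖) + ‖r.2 - q‖ * M) := by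
      fun_prop
    have c2 : Tendsto (fun r : Plane × Plane => ‖r.1 - z‖) (𝓝 (z, q)) (𝓝[≥] 0) := by
      refine tendsto_nhdsWithin_iff.2 ⟨?_, Eventually.of_forall fun r => norm_nonneg _⟩
      have : Continuous (fun r : Plane × Plane => ‖r.1 - z‖) := by fun_prop
      simpa using this.tendsto (z, q)
    simpa using (c1.tendsto (z, q)).add (hω.comp c2)
  rw [ContinuousAt, tendsto_iff_dist_tendsto_zero]
  refine squeeze_zero (fun _ => dist_nonneg) (fun r => ?_) hlim
  rw [Real.dist_eq]
  refine abs_controlHam_sub_le (hD.ctrl_nonempty i) (hD.bddAbove_image i _ subset_rfl _)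
    (hD.bddAbove_image i _ subset_rfl _) fun a ha => ?_
  have e : (-(inner ℝ r.2 (D.f i r.1 a)) - D.cost i r.1 a) -
      (-(inner ℝ q (D.f i z a)) - D.cost i z a) =
      -(inner ℝ r.2 (D.f i r.1 a - D.f i z a) + inner ℝ (r.2 - q) (D.f i z a) +
        (D.cost i r.1 a - D.cost i z a)) := by
    rw [inner_sub_left, inner_sub_right]; ring
  rw [e, abs_neg]
  refine (abs_add_three _ _ _).trans ?_
  gcongr
  · exact (abs_real_inner_le_norm _ _).trans
      (mul_le_mul_of_nonneg_left (hKf i _ _ a ha) (norm_nonneg _))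
  · exact (abs_real_inner_le_norm _ _).trans
      (mul_le_mul_of_nonneg_left (hM i _ a ha) (norm_nonneg _))
  · exact hωl i _ _ a ha

lemma exists_bound_g : ∃ G, ∀ t, ‖D.g t‖ ≤ G := by
  obtain ⟨G, hG⟩ := (isCompact_Icc (a := (0 : ℝ)) (b := 1)).exists_bound_of_continuousOn
    hD.g_smooth.continuous.continuousOn
  refine ⟨G, fun t => ?_⟩
  obtain ⟨y, hy, e⟩ := hD.g_periodic.exists_mem_Ico₀ one_pos t
  rw [e]; exact hG y ⟨hy.1, hy.2.le⟩

/-- Controllability on the straight interface, which is a limit of the oscillating ones. -/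
lemma controllable_interface : ∃ δ : ℝ, 0 < δ ∧ ∀ i, ∀ z ∈ interface,
    Metric.ball (0 : Plane) δ ⊆ (fun a => D.f i z a) '' D.ctrl i := by
  obtain ⟨δ, hδ, h⟩ := hD.controllable
  refine ⟨δ, hδ, fun i z hz v hv => ?_⟩
  have hz0 : z 0 = 0 := hz
  obtain ⟨K, hK, hKf⟩ := hD.f_lipschitz
  obtain ⟨G, hG⟩ := hD.exists_bound_g
  have hcl : IsClosed ((fun a => D.f i z a) '' D.ctrl i) :=
    ((hD.ctrl_compact i).image_of_continuousOn (hD.continuousOn_f i z)).isClosed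
  rw [← hcl.closure_eq, Metric.mem_closure_iff]
  intro κ hκ
  have hG0 : 0 ≤ G := (norm_nonneg _).trans (hG 0)
  -- The point of `Γ_ε` with the same tangential coordinate as `z` is within `εG` of `z`, so its
  -- velocities differ from those at `z` by at most `KεG`.
  obtain ⟨ε, hε, hεκ⟩ : ∃ ε : ℝ, 0 < ε ∧ K * (ε * G) < κ := by
    refine ⟨κ / (K * (G + 1)), by positivity, ?_⟩
    have : K * (κ / (K * (G + 1)) * G) = κ * (G / (G + 1)) := by field_simp
    rw [this]
    have : G / (G + 1) < 1 := by rw [div_lt_one (by linarith)]; linarith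
    nlinarith
  obtain ⟨a, ha, hav⟩ := h ε hε i !₂[ε * D.g (z 1 / ε), z 1] (by simp [oscInterface]) hv
  refine ⟨_, ⟨a, ha, rfl⟩, ?_⟩
  simp only at hav ⊢
  rw [← hav, dist_eq_norm]
  refine (hKf i _ _ a ha).trans_lt (lt_of_le_of_lt ?_ hεκ)
  gcongr
  have : !₂[ε * D.g (z 1 / ε), z 1] - z = !₂[ε * D.g (z 1 / ε), 0] :=
    plane_ext (by simp [hz0]) (by simp)
  rw [this, EuclideanSpace.norm_eq, Fin.sum_univ_two]
  simp only [Matrix.cons_val_zero, Matrix.cons_val_one]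
  simp only [norm_zero, ne_eq, OfNat.ofNat_ne_zero, not_false_eq_true, zero_pow, add_zero]
  rw [Real.sqrt_sq (norm_nonneg _), norm_mul, Real.norm_of_nonneg hε.le]
  gcongr
  exact hG _

/-- On the interface, every small normal velocity is achieved by a control. -/
lemma exists_control_normal : ∃ δ : ℝ, 0 < δ ∧ ∀ i, ∀ z ∈ interface, ∀ t : ℝ, |t| ≤ δ →
    ∃ a ∈ D.ctrl i, D.f i z a = !₂[t, 0] := by
  obtain ⟨δ, hδ, h⟩ := hD.controllable_interface
  refine ⟨δ / 2, by positivity, fun i z hz t ht => ?_⟩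
  have : !₂[t, 0] ∈ Metric.ball (0 : Plane) δ := by
    rw [mem_ball_zero_iff, EuclideanSpace.norm_eq, Fin.sum_univ_two]
    simp only [Matrix.cons_val_zero, Matrix.cons_val_one]
    simp only [norm_zero, ne_eq, OfNat.ofNat_ne_zero, not_false_eq_true, zero_pow, add_zero]
    rw [Real.sqrt_sq (norm_nonneg _), Real.norm_eq_abs]
    linarith
  obtain ⟨a, ha, e⟩ := h i z hz this
  exact ⟨a, ha, e⟩

lemma exists_convex_combination {i : Side} {z : Plane} {a b : A} (ha : a ∈ D.ctrl i) (hb : b ∈ D.ctrl i) {θ : ℝ}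
    (h0 : 0 ≤ θ) (h1 : θ ≤ 1) : ∃ c ∈ D.ctrl i,
      D.f i z c = (1 - θ) • D.f i z a + θ • D.f i z b ∧
      D.cost i z c = (1 - θ) * D.cost i z a + θ * D.cost i z b := by
  obtain ⟨c, hc, e⟩ := (hD.closed_convex i z).2 ⟨a, ha, rfl⟩ ⟨b, hb, rfl⟩
    (sub_nonneg.2 h1) h0 (by ring)
  exact ⟨c, hc, congrArg Prod.fst e, congrArg Prod.snd e⟩

variable {i : Side} {z : Plane} (hz : z ∈ interface)
include hz

lemma plus_nonempty (i : Side) : {a ∈ D.ctrl i | 0 ≤ i.sign * D.f i z a 0}.Nonempty := by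
  obtain ⟨δ, hδ, h⟩ := hD.exists_control_normal
  obtain ⟨a, ha, e⟩ := h i z hz 0 (by simpa using hδ.le)
  exact ⟨a, ha, by simp [e]⟩

lemma minus_nonempty (i : Side) : {a ∈ D.ctrl i | 0 ≤ -(i.sign * D.f i z a 0)}.Nonempty := by
  obtain ⟨δ, hδ, h⟩ := hD.exists_control_normal
  obtain ⟨a, ha, e⟩ := h i z hz 0 (by simpa using hδ.le)
  exact ⟨a, ha, by simp [e]⟩

lemma H_eq_max (i : Side) (p : Plane) : D.H i z p = max (D.Hplus i z p) (D.Hminus i z p) := by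
  refine le_antisymm (controlHam_le (hD.ctrl_nonempty i) fun a ha => ?_) (max_le ?_ ?_)
  · rcases le_total 0 (i.sign * D.f i z a 0) with h | h
    · exact (hD.le_Hplus i z p ha h).trans (le_max_left _ _)
    · exact (hD.le_Hminus i z p ha (neg_nonneg.2 h)).trans (le_max_right _ _)
  · exact controlHam_le (hD.plus_nonempty hz i) fun a ha => hD.le_H i z p ha.1
  · exact controlHam_le (hD.minus_nonempty hz i) fun a ha => hD.le_H i z p ha.1

lemma Hplus_le_of_le {p q : Plane} (h0 : i.sign * p 0 ≤ i.sign * q 0) (h1 : p 1 = q 1) :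
    D.Hplus i z q ≤ D.Hplus i z p := by
  refine controlHam_le (hD.plus_nonempty hz i) fun a ha => ?_
  refine le_trans ?_ (hD.le_Hplus i z p ha.1 ha.2)
  rw [inner_plane, inner_plane, h1]
  have h := mul_le_mul_of_nonneg_right h0 ha.2
  have e : ∀ t : ℝ, i.sign * t * (i.sign * D.f i z a 0) = t * D.f i z a 0 := fun t => by
    linear_combination (t * D.f i z a 0) * i.sign_mul_self
  rw [e, e] at h
  linarith

lemma Hminus_le_of_le {p q : Plane} (h0 : i.sign * p 0 ≤ i.sign * q 0) (h1 : p 1 = q 1) :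
    D.Hminus i z p ≤ D.Hminus i z q := by
  refine controlHam_le (hD.minus_nonempty hz i) fun a ha => ?_
  refine le_trans ?_ (hD.le_Hminus i z q ha.1 ha.2)
  rw [inner_plane, inner_plane, h1]
  have h := mul_le_mul_of_nonneg_right h0 ha.2
  have e : ∀ t : ℝ, i.sign * t * -(i.sign * D.f i z a 0) = -(t * D.f i z a 0) := fun t => by
    linear_combination (-t * D.f i z a 0) * i.sign_mul_self
  rw [e, e] at h
  linarith

lemma continuous_Hplus (i : Side) : Continuous (D.Hplus i z) := by
  obtain ⟨M, hM⟩ := hD.f_bounded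
  obtain ⟨M', hM'⟩ := hD.cost_bounded
  exact continuous_controlHam (hD.plus_nonempty hz i) (fun a ha => hM i z a ha.1)
    (fun a ha => hM' i z a ha.1)

lemma continuous_Hminus (i : Side) : Continuous (D.Hminus i z) := by
  obtain ⟨M, hM⟩ := hD.f_bounded
  obtain ⟨M', hM'⟩ := hD.cost_bounded
  exact continuous_controlHam (hD.minus_nonempty hz i) (fun a ha => hM i z a ha.1)
    (fun a ha => hM' i z a ha.1)

/-- `H^{±,i}` grow at least linearly with the slope, in opposite directions. -/
lemma exists_growth (i : Side) : ∃ c C : ℝ, 0 < c ∧ ∀ s p₂ : ℝ,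
    -c * s - C ≤ D.Hplus i z !₂[i.sign * s, p₂] ∧ c * s - C ≤ D.Hminus i z !₂[i.sign * s, p₂] := by
  obtain ⟨δ, hδ, h⟩ := hD.exists_control_normal
  obtain ⟨M', hM'⟩ := hD.cost_bounded
  refine ⟨δ, M', hδ, fun s p₂ => ?_⟩
  obtain ⟨a, ha, ea⟩ := h i z hz (i.sign * δ) (by rw [i.abs_sign_mul, abs_of_pos hδ])
  obtain ⟨b, hb, eb⟩ := h i z hz (i.sign * -δ) (by rw [i.abs_sign_mul, abs_neg, abs_of_pos hδ])
  constructor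
  · refine le_trans ?_ (hD.le_Hplus i z _ ha ?_)
    · rw [inner_plane, ea]
      have := (abs_le.1 (hM' i z a ha)).2
      simp only [Matrix.cons_val_zero, Matrix.cons_val_one]
      have e : i.sign * s * (i.sign * δ) = s * δ := by
        linear_combination (s * δ) * i.sign_mul_self
      rw [e]; linarith
    · simp [ea, i.sign_mul_sign_mul, hδ.le]
  · refine le_trans ?_ (hD.le_Hminus i z _ hb ?_)
    · rw [inner_plane, eb]
      have := (abs_le.1 (hM' i z b hb)).2
      simp only [Matrix.cons_val_zero, Matrix.cons_val_one]
      have e : i.sign * s * (i.sign * -δ) = -(s * δ) := by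
        linear_combination (-s * δ) * i.sign_mul_self
      rw [e]; linarith
    · have : i.sign * (i.sign * -δ) = -δ := i.sign_mul_sign_mul _
      simp only [eb, PiLp.toLp_apply, Matrix.cons_val_zero, this]; linarith

/-- The minimum of `H^i` over the slopes is attained where `H^{+,i} = H^{-,i}`, and is the value
of a control that is tangent to the interface. -/
lemma exists_tangential_control (i : Side) (p₂ : ℝ) : ∃ s : ℝ, ∃ a ∈ D.ctrl i,
    D.f i z a 0 = 0 ∧
    D.Hplus i z !₂[i.sign * s, p₂] = D.Hminus i z !₂[i.sign * s, p₂] ∧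
    D.Hminus i z !₂[i.sign * s, p₂] = -(p₂ * D.f i z a 1) - D.cost i z a := by
  obtain ⟨c, C, hc, hg⟩ := hD.exists_growth hz i
  have hmono : ∀ s t : ℝ, s ≤ t →
      D.Hplus i z !₂[i.sign * t, p₂] ≤ D.Hplus i z !₂[i.sign * s, p₂] ∧
      D.Hminus i z !₂[i.sign * s, p₂] ≤ D.Hminus i z !₂[i.sign * t, p₂] := fun s t hst =>
    ⟨hD.Hplus_le_of_le hz (by simpa [i.sign_mul_sign_mul] using hst) rfl,
      hD.Hminus_le_of_le hz (by simpa [i.sign_mul_sign_mul] using hst) rfl⟩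
  have hvec : Continuous fun s : ℝ => (!₂[i.sign * s, p₂] : Plane) := by fun_prop
  have hcont : Continuous fun s : ℝ =>
      D.Hminus i z !₂[i.sign * s, p₂] - D.Hplus i z !₂[i.sign * s, p₂] :=
    ((hD.continuous_Hminus hz i).comp hvec).sub ((hD.continuous_Hplus hz i).comp hvec)
  -- The two terms cross because each grows linearly at one end while the other, by monotonicity,
  -- stays below its value at `0`.
  obtain ⟨s, hs⟩ : (0 : ℝ) ∈ Set.range fun s : ℝ =>
      D.Hminus i z !₂[i.sign * s, p₂] - D.Hplus i z !₂[i.sign * s, p₂] := by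
    apply mem_range_of_exists_le_of_exists_ge hcont
    · set m := |D.Hminus i z !₂[i.sign * 0, p₂] + C| / c with hm
      have hm0 : 0 ≤ m := by positivity
      refine ⟨-m, ?_⟩
      have h1 := (hmono (-m) 0 (by linarith)).2
      have h2 := (hg (-m) p₂).1
      have h3 : c * m = |D.Hminus i z !₂[i.sign * 0, p₂] + C| := by rw [hm]; field_simp
      have h4 := le_abs_self (D.Hminus i z !₂[i.sign * 0, p₂] + C)
      linarith
    · set m := |D.Hplus i z !₂[i.sign * 0, p₂] + C| / c with hm
      have hm0 : 0 ≤ m := by positivity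
      refine ⟨m, ?_⟩
      have h1 := (hmono 0 m hm0).1
      have h2 := (hg m p₂).2
      have h3 : c * m = |D.Hplus i z !₂[i.sign * 0, p₂] + C| := by rw [hm]; field_simp
      have h4 := le_abs_self (D.Hplus i z !₂[i.sign * 0, p₂] + C)
      linarith
  have hs' : D.Hplus i z !₂[i.sign * s, p₂] = D.Hminus i z !₂[i.sign * s, p₂] := by
    simp only at hs; linarith
  have hf0 : ContinuousOn (fun a => i.sign * D.f i z a 0) (D.ctrl i) :=
    continuousOn_const.mul
      ((EuclideanSpace.proj (𝕜 := ℝ) (0 : Fin 2)).continuous.comp_continuousOn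
        (hD.continuousOn_f i z))
  have hcp : IsCompact {a ∈ D.ctrl i | 0 ≤ i.sign * D.f i z a 0} := by
    refine (hD.ctrl_compact i).of_isClosed_subset ?_ fun _ h => h.1
    exact hf0.preimage_isClosed_of_isClosed (hD.ctrl_compact i).isClosed isClosed_Ici
  have hcm : IsCompact {a ∈ D.ctrl i | 0 ≤ -(i.sign * D.f i z a 0)} := by
    refine (hD.ctrl_compact i).of_isClosed_subset ?_ fun _ h => h.1
    exact hf0.neg.preimage_isClosed_of_isClosed (hD.ctrl_compact i).isClosed isClosed_Ici
  obtain ⟨a, ha, ea⟩ := exists_controlHam_eq (hD.plus_nonempty hz i) hcp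
    ((hD.continuousOn_f i z).mono fun _ h => h.1) ((hD.continuousOn_cost i z).mono fun _ h => h.1)
    !₂[i.sign * s, p₂]
  obtain ⟨b, hb, eb⟩ := exists_controlHam_eq (hD.minus_nonempty hz i) hcm
    ((hD.continuousOn_f i z).mono fun _ h => h.1) ((hD.continuousOn_cost i z).mono fun _ h => h.1)
    !₂[i.sign * s, p₂]
  change D.Hplus i z _ = _ at ea
  change D.Hminus i z _ = _ at eb
  -- At the crossing slope the maximizers `a` of `H^{+,i}` and `b` of `H^{-,i}` give the same value,
  -- and their normal velocities have opposite signs. The mixture with zero normal velocity is a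
  -- control by convexity, and it attains that common value too.
  obtain ⟨θ, h0, h1, hθ⟩ : ∃ θ : ℝ, 0 ≤ θ ∧ θ ≤ 1 ∧
      (1 - θ) * D.f i z a 0 + θ * D.f i z b 0 = 0 := by
    have hx := ha.2
    have hy := hb.2
    set x := i.sign * D.f i z a 0 with ex
    set y := i.sign * D.f i z b 0 with ey
    have hf : ∀ θ : ℝ, (1 - θ) * D.f i z a 0 + θ * D.f i z b 0
        = i.sign * ((1 - θ) * x + θ * y) := fun θ => by
      rw [ex, ey]
      linear_combination -((1 - θ) * D.f i z a 0 + θ * D.f i z b 0) * i.sign_mul_self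
    rcases hx.eq_or_lt with h | h
    · exact ⟨0, le_rfl, zero_le_one, by rw [hf, ← h]; ring⟩
    · have : 0 < x - y := by linarith
      refine ⟨x / (x - y), by positivity, (div_le_one this).2 (by linarith), ?_⟩
      rw [hf]; field_simp; ring
  obtain ⟨c, hc, fc, lc⟩ := hD.exists_convex_combination ha.1 hb.1 h0 h1
  have fc0 : D.f i z c 0 = 0 := by rw [fc]; simpa using hθ
  refine ⟨s, c, hc, fc0, hs', ?_⟩
  rw [inner_plane] at ea eb
  have fc1 : D.f i z c 1 = (1 - θ) * D.f i z a 1 + θ * D.f i z b 1 := by rw [fc]; simp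
  simp only [Matrix.cons_val_zero, Matrix.cons_val_one] at ea eb
  rw [fc1, lc]
  rw [hs'] at ea
  linear_combination (1 - θ) * ea + θ * eb - (i.sign * s) * hθ

end StandingAssumptions
end ControlData

/-! ### Half-planes, one-sided gradients, and maxima on the periodic strip. -/

lemma halfPlane_subset_closedHalfPlane (i : Side) : halfPlane i ⊆ closedHalfPlane i :=
  fun x (h : 0 < i.sign * x 0) => (h.le : 0 ≤ i.sign * x 0)

lemma isOpen_halfPlane (i : Side) : IsOpen (halfPlane i) :=
  isOpen_lt continuous_const (by fun_prop)

lemma closedHalfPlane_mem_nhds {i : Side} {x : Plane} (hx : x ∈ halfPlane i) :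
    closedHalfPlane i ∈ 𝓝 x :=
  mem_of_superset ((isOpen_halfPlane i).mem_nhds hx) (halfPlane_subset_closedHalfPlane i)

lemma convex_closedHalfPlane (i : Side) : Convex ℝ (closedHalfPlane i) := by
  intro x hx y hy a b ha hb _
  have hx' : 0 ≤ i.sign * x 0 := hx
  have hy' : 0 ≤ i.sign * y 0 := hy
  change 0 ≤ i.sign * (a • x + b • y) 0
  simp only [PiLp.add_apply, PiLp.smul_apply, smul_eq_mul]
  nlinarith [mul_nonneg ha hx', mul_nonneg hb hy']

lemma uniqueDiffOn_closedHalfPlane (i : Side) : UniqueDiffOn ℝ (closedHalfPlane i) := by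
  refine uniqueDiffOn_convex (convex_closedHalfPlane i) ⟨!₂[i.sign, 0], ?_⟩
  rw [mem_interior_iff_mem_nhds]
  refine closedHalfPlane_mem_nhds ?_
  simp [halfPlane, i.sign_mul_self]

lemma interface_subset_closedHalfPlane (i : Side) : interface ⊆ closedHalfPlane i := by
  intro z hz
  have hz : z 0 = 0 := hz
  simp [closedHalfPlane, hz]

/-- A closed half-plane is convex with nonempty interior, so derivatives within it are unique, even
at points of `Γ`. -/
lemma sideGrad_eq_of_hasFDerivWithinAt {φ : Plane → ℝ} {L : Plane →L[ℝ] ℝ} {i : Side} {x : Plane}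
    (h : HasFDerivWithinAt φ L (closedHalfPlane i) x) (hx : x ∈ closedHalfPlane i) :
    sideGrad φ i x = !₂[L !₂[1, 0], L !₂[0, 1]] := by
  have key : ∀ v : Plane, inner ℝ (sideGrad φ i x) v = L v := fun v => by
    rw [sideGrad, gradientWithin, h.fderivWithin (uniqueDiffOn_closedHalfPlane i x hx),
      InnerProductSpace.toDual_symm_apply]
  refine plane_ext ?_ ?_
  · have := key !₂[1, 0]
    simpa [inner_plane] using this
  · have := key !₂[0, 1]
    simpa [inner_plane] using this

lemma hasDerivAt_line_fst (a t : ℝ) :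
    HasDerivAt (fun s : ℝ => (!₂[s, a] : Plane)) !₂[1, 0] t := by
  have e : (fun s : ℝ => (!₂[s, a] : Plane)) = fun s => s • !₂[1, 0] + !₂[0, a] := by
    funext s; refine plane_ext ?_ ?_ <;> simp
  rw [e]
  simpa using ((hasDerivAt_id t).smul_const (!₂[1, 0] : Plane)).add_const (!₂[0, a] : Plane)

lemma hasDerivAt_line_snd (a t : ℝ) :
    HasDerivAt (fun s : ℝ => (!₂[a, s] : Plane)) !₂[0, 1] t := by
  have e : (fun s : ℝ => (!₂[a, s] : Plane)) = fun s => s • !₂[0, 1] + !₂[a, 0] := by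
    funext s; refine plane_ext ?_ ?_ <;> simp
  rw [e]
  simpa using ((hasDerivAt_id t).smul_const (!₂[0, 1] : Plane)).add_const (!₂[a, 0] : Plane)

lemma eta_plane (x : Plane) : (!₂[x 0, x 1] : Plane) = x := plane_ext rfl rfl

/-- The gradient of a differentiable function in terms of its partial derivatives. -/
lemma sideGrad_eq_of_hasDerivAt {φ : Plane → ℝ} {i : Side} {x : Plane} {d₀ d₁ : ℝ}
    (h : DifferentiableAt ℝ φ x) (hx : x ∈ closedHalfPlane i)
    (h₀ : HasDerivAt (fun t => φ !₂[t, x 1]) d₀ (x 0))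
    (h₁ : HasDerivAt (fun t => φ !₂[x 0, t]) d₁ (x 1)) : sideGrad φ i x = !₂[d₀, d₁] := by
  rw [sideGrad_eq_of_hasFDerivWithinAt h.hasFDerivAt.hasFDerivWithinAt hx]
  have hφ := h.hasFDerivAt
  rw [← eta_plane x] at hφ
  have e₀ := (hφ.comp_hasDerivAt (x 0) (hasDerivAt_line_fst (x 1) (x 0))).unique h₀
  have e₁ := (hφ.comp_hasDerivAt (x 1) (hasDerivAt_line_snd (x 0) (x 1))).unique h₁
  rw [eta_plane] at e₀ e₁
  rw [e₀, e₁]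

lemma IsTestFunction.of_contDiff {φ : Plane → ℝ} (h : ContDiff ℝ 1 φ) : IsTestFunction φ :=
  ⟨h.continuous, fun _ => h.contDiffOn⟩

/-- A continuous function on the strip that is periodic along it attains its maximum. -/
lemma exists_isMaxOn_strip {w : Plane → ℝ} {ρ : ℝ} (hρ : 0 < ρ) (hw : ContinuousOn w (strip ρ))
    (hper : ∀ y ∈ strip ρ, w (y + !₂[0, 1]) = w y) : ∃ y ∈ strip ρ, IsMaxOn w (strip ρ) y := by
  have hmap : Continuous fun q : ℝ × ℝ => (!₂[q.1, q.2] : Plane) := by fun_prop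
  have hc : IsCompact ((fun q : ℝ × ℝ => (!₂[q.1, q.2] : Plane)) ''
      (Set.Icc (-ρ) ρ ×ˢ Set.Icc 0 1)) := (isCompact_Icc.prod isCompact_Icc).image hmap
  have hsub : (fun q : ℝ × ℝ => (!₂[q.1, q.2] : Plane)) '' (Set.Icc (-ρ) ρ ×ˢ Set.Icc 0 1) ⊆
      strip ρ := by
    rintro _ ⟨q, hq, rfl⟩
    exact abs_le.2 ⟨hq.1.1, hq.1.2⟩
  obtain ⟨y, hy, hmax⟩ := hc.exists_isMaxOn ⟨!₂[0, 0], (0, 0), by simp [hρ.le], rfl⟩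
    (hw.mono hsub)
  refine ⟨y, hsub hy, fun x hx => ?_⟩
  have hline : ∀ t : ℝ, (!₂[x 0, t] : Plane) ∈ strip ρ := fun t => hx
  have hp : Function.Periodic (fun t => w !₂[x 0, t]) 1 := fun t => by
    simp only
    rw [← hper _ (hline t)]
    congr 1
    exact plane_ext (by simp) (by simp)
  obtain ⟨t, ht, et⟩ := hp.exists_mem_Ico₀ one_pos (x 1)
  have hx' : w x = w !₂[x 0, t] := by rw [← et, eta_plane]
  change w x ≤ w y
  rw [hx']
  exact hmax ⟨(x 0, t), ⟨abs_le.1 hx, ⟨ht.1, ht.2.le⟩⟩, rfl⟩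

/-! ### The lower bound on the effective Hamiltonian. -/

namespace ControlData

variable {A : Type*} {D : ControlData A}

lemma cellHam_of_mem_halfPlane {ρ z₂ p₂ : ℝ} {φ : Plane → ℝ} {y : Plane} {i : Side}
    (hy : 0 < i.sign * y 0) (hyρ : i.sign * y 0 < ρ) :
    D.cellHam ρ z₂ p₂ φ y = D.Ht i !₂[0, z₂] (sideGrad φ i y + !₂[0, p₂]) (y 1) := by
  cases i
  · simp only [Side.sign] at hy hyρ
    have h0 : y 0 < 0 := by linarith
    rw [cellHam, if_neg h0.ne, if_neg (by linarith : -ρ < y 0).ne',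
      if_neg (by linarith : y 0 < ρ).ne, if_pos h0]
  · simp only [Side.sign] at hy hyρ
    have h0 : 0 < y 0 := by linarith
    rw [cellHam, if_neg h0.ne', if_neg (by linarith : -ρ < y 0).ne',
      if_neg (by linarith : y 0 < ρ).ne, if_neg h0.le.not_gt]

/-- The sheared image of a tangential velocity is parallel to `(-g', 1)`, hence orthogonal to `(1,
g')`: a multiple of `(1, g')` in the momentum contributes nothing, however large. -/
lemma inner_shear_eq (q : ℝ) (p : Plane) (v : Plane) {g : ℝ → ℝ} {y₂ : ℝ} (hv : v 0 = 0)
    (hp : p 1 = p 0 * deriv g y₂ + q) : inner ℝ p (shear g y₂ v) = q * v 1 := by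
  rw [inner_plane, hp]
  simp [shear, hv]
  ring

namespace StandingAssumptions

variable [MetricSpace A] (hD : D.StandingAssumptions)
include hD

lemma le_Ht (i : Side) (z p : Plane) (y₂ : ℝ) {a : A} (ha : a ∈ D.ctrl i) :
    -(inner ℝ p (shear D.g y₂ (D.f i z a))) - D.cost i z a ≤ D.Ht i z p y₂ := by
  refine le_controlHam (F := fun a => shear D.g y₂ (D.f i z a)) ?_ ha
  refine (hD.ctrl_compact i).bddAbove_image ?_
  have hs : Continuous (shear D.g y₂) := by unfold shear; fun_prop
  exact (continuousOn_const.inner (hs.comp_continuousOn (hD.continuousOn_f i z))).neg.sub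
    (hD.continuousOn_cost i z)

/-- Testing the truncated cell problem with a large multiple of `(y₁ + g(y₂) - m)²` bounds its
ergodic constant from below by the running cost of any control tangent to the interface. -/
lemma le_of_isErgodicConstant {i : Side} {z₂ p₂ : ℝ} {a : A} (ha : a ∈ D.ctrl i)
    (h0 : D.f i !₂[0, z₂] a 0 = 0) : ∃ ρ₀ : ℝ, ∀ ρ, ρ₀ ≤ ρ → ∀ μ, D.IsErgodicConstant ρ z₂ p₂ μ →
      -(p₂ * D.f i !₂[0, z₂] a 1) - D.cost i !₂[0, z₂] a ≤ μ := by
  obtain ⟨G, hG⟩ := hD.exists_bound_g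
  have hG0 : 0 ≤ G := (norm_nonneg _).trans (hG 0)
  refine ⟨4 * G + 2, fun ρ hρ μ ⟨u, ⟨C, hC⟩, hu⟩ => ?_⟩
  have hρ0 : 0 < ρ := by linarith
  -- The penalty is centred midway across the side `i` of the strip, so that a maximum point within
  -- `ρ / 2` of it avoids both `Γ` and the outer boundary.
  set m := i.sign * (ρ / 2) with hm
  have hm' : i.sign * m = ρ / 2 := i.sign_mul_sign_mul _
  have hmabs : |m| = ρ / 2 := by rw [hm, i.abs_sign_mul, abs_of_pos (by linarith)]
  have hmem : (!₂[m, 0] : Plane) ∈ strip ρ := by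
    change |m| ≤ ρ
    rw [hmabs]; linarith
  have hC0 : 0 ≤ C := (abs_nonneg _).trans (hC _ hmem)
  -- If `|y₁ - m| ≥ ρ/2 ≥ 2G + 1`, then `φ` exceeds its value at `(m, 0)` by at least `(2C + 1)((G +
  -- 1)² - G²)`, more than the oscillation `2C` of `u`. The gradient of `φ` is a multiple of `(1,
  -- g'(y₂))`, which the tangent control does not see.
  set φ : Plane → ℝ := fun y => (2 * C + 1) * (y 0 + D.g (y 1) - m) ^ 2 with hφ
  have hg1 : ContDiff ℝ 1 D.g := hD.g_smooth.of_le (by norm_num)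
  have hφC : ContDiff ℝ 1 φ := by
    have h1 : ContDiff ℝ 1 fun y : Plane => D.g (y 1) :=
      hg1.comp (EuclideanSpace.proj (𝕜 := ℝ) (1 : Fin 2)).contDiff
    have h2 : ContDiff ℝ 1 fun y : Plane => y 0 :=
      (EuclideanSpace.proj (𝕜 := ℝ) (0 : Fin 2)).contDiff
    exact contDiff_const.mul (((h2.add h1).sub contDiff_const).pow 2)
  obtain ⟨y, hy, hmax⟩ := exists_isMaxOn_strip (w := fun y => u y - φ y) hρ0
    (hu.continuousOn.sub hφC.continuous.continuousOn) fun y hy => by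
      have e : D.g (y 1 + 1) = D.g (y 1) := hD.g_periodic (y 1)
      simp [hu.periodic y hy, hφ, e]
  have hcmp : u !₂[m, 0] - φ !₂[m, 0] ≤ u y - φ y := hmax hmem
  have hφm : φ !₂[m, 0] ≤ (2 * C + 1) * G ^ 2 := by
    have : φ !₂[m, 0] = (2 * C + 1) * D.g 0 ^ 2 := by simp [hφ]
    rw [this]
    have := sq_le_sq' (abs_le.1 (hG 0)).1 (abs_le.1 (hG 0)).2
    gcongr
  have hum := (abs_le.1 (hC _ hmem)).1
  have huy := (abs_le.1 (hC _ hy)).2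
  have hnear : |y 0 - m| < ρ / 2 := by
    by_contra! hcon
    have h1 : G + 1 ≤ |y 0 + D.g (y 1) - m| := by
      have h2 := abs_sub_abs_le_abs_sub (y 0 - m) (-D.g (y 1))
      rw [abs_neg] at h2
      have h3 := hG (y 1)
      rw [Real.norm_eq_abs] at h3
      have e : y 0 - m - -D.g (y 1) = y 0 + D.g (y 1) - m := by ring
      rw [e] at h2
      linarith
    have h4 : (G + 1) ^ 2 ≤ (y 0 + D.g (y 1) - m) ^ 2 := by
      rw [← sq_abs (y 0 + D.g (y 1) - m)]
      exact pow_le_pow_left₀ (by linarith) h1 2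
    have h5 : (2 * C + 1) * (G + 1) ^ 2 ≤ φ y := mul_le_mul_of_nonneg_left h4 (by linarith)
    nlinarith [mul_nonneg hC0 hG0]
  have hin : 0 < i.sign * y 0 ∧ i.sign * y 0 < ρ := by
    have h1 : |i.sign * (y 0 - m)| < ρ / 2 := by rwa [i.abs_sign_mul]
    rw [mul_sub, hm', abs_lt] at h1
    constructor <;> linarith [h1.1, h1.2]
  have hsub := hu.sub y hy φ (.of_contDiff hφC) hmax.localize
  rw [cellHam_of_mem_halfPlane hin.1 hin.2] at hsub
  refine le_trans ?_ hsub
  refine le_trans (le_of_eq ?_) (hD.le_Ht i _ _ _ ha)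
  set r := y 0 + D.g (y 1) - m with hr
  have hg' : HasDerivAt D.g (deriv D.g (y 1)) (y 1) :=
    (hg1.differentiable (by norm_num) (y 1)).hasDerivAt
  have hgrad : sideGrad φ i y =
      !₂[(2 * C + 1) * (2 * r), (2 * C + 1) * (2 * r) * deriv D.g (y 1)] := by
    refine sideGrad_eq_of_hasDerivAt (hφC.differentiable (by norm_num) y) hin.1.le ?_ ?_
    · have := (((((hasDerivAt_id (y 0)).add_const (D.g (y 1))).sub_const m).pow 2).const_mul
        (2 * C + 1))
      refine this.congr_deriv ?_
      simp [hr]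
    · have := ((((hg'.const_add (y 0)).sub_const m).pow 2).const_mul (2 * C + 1))
      refine this.congr_deriv ?_
      simp [hr]; ring
  rw [inner_shear_eq p₂ _ _ h0]
  rw [hgrad]; simp

/-- The bound for `λ_ρ` with `ρ` large passes to the limit. The conventional value `E₀` satisfies it
as well, since a tangent control bounds `H^i` below for every normal slope; existence of the ergodic
constants is therefore never needed. -/
lemma le_E {i : Side} {z₂ p₂ : ℝ} {a : A} (ha : a ∈ D.ctrl i) (h0 : D.f i !₂[0, z₂] a 0 = 0) :
    -(p₂ * D.f i !₂[0, z₂] a 1) - D.cost i !₂[0, z₂] a ≤ D.E z₂ p₂ := by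
  unfold E
  split_ifs with h
  · obtain ⟨μ, hμ, hlim⟩ := h.choose_spec
    obtain ⟨ρ₀, hρ₀⟩ := hD.le_of_isErgodicConstant (p₂ := p₂) ha h0
    refine ge_of_tendsto hlim ?_
    filter_upwards [eventually_ge_atTop ρ₀, eventually_gt_atTop 0] with ρ h1 h2
    exact hρ₀ ρ h1 _ (hμ ρ h2)
  · have : -(p₂ * D.f i !₂[0, z₂] a 1) - D.cost i !₂[0, z₂] a ≤ D.E₀side i z₂ p₂ := by
      refine le_csInf (Set.range_nonempty _) ?_
      rintro _ ⟨q, rfl⟩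
      refine le_trans (le_of_eq ?_) (hD.le_H i _ _ ha)
      rw [inner_plane, h0]
      simp
    refine this.trans ?_
    cases i
    · exact le_max_left _ _
    · exact le_max_right _ _

/-! ### Critical slopes and the admissible selections. -/

/-- Start at the crossing slope, where `H^{-,i} = H^{+,i} ≤ E`, and increase `s` until `H^{-,i}`
reaches `E`; meanwhile `H^{+,i}` can only decrease, so `H^i = H^{-,i}` there. -/
lemma criticalSlopes_nonempty (i : Side) (z₂ p₂ : ℝ) : (D.criticalSlopes i z₂ p₂).Nonempty := by
  have hz : (!₂[0, z₂] : Plane) ∈ interface := by simp [interface]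
  obtain ⟨c, C, hc, hg⟩ := hD.exists_growth hz i
  have hvec : Continuous fun s : ℝ => (!₂[i.sign * s, p₂] : Plane) := by fun_prop
  have hm : Continuous fun s : ℝ => D.Hminus i !₂[0, z₂] !₂[i.sign * s, p₂] :=
    (hD.continuous_Hminus hz i).comp hvec
  obtain ⟨s, a, ha, h0, hpm, hsa⟩ := hD.exists_tangential_control hz i p₂
  have hE := hD.le_E (p₂ := p₂) ha h0
  rw [← hsa] at hE
  obtain ⟨t, hst, ht⟩ : ∃ t, s ≤ t ∧ (D.E z₂ p₂ + C) / c ≤ t :=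
    ⟨_, le_max_left _ _, le_max_right _ _⟩
  have hEt : D.E z₂ p₂ ≤ D.Hminus i !₂[0, z₂] !₂[i.sign * t, p₂] := by
    have h1 := (hg t p₂).2
    rw [div_le_iff₀ hc] at ht
    linarith
  obtain ⟨r, hr, er⟩ := intermediate_value_Icc hst hm.continuousOn ⟨hE, hEt⟩
  refine ⟨i.sign * r, ?_, er⟩
  rw [hD.H_eq_max hz, max_eq_right]
  have hpr : D.Hplus i !₂[0, z₂] !₂[i.sign * r, p₂] ≤ D.Hplus i !₂[0, z₂] !₂[i.sign * s, p₂] := by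
    refine hD.Hplus_le_of_le hz ?_ rfl
    simpa [i.sign_mul_sign_mul] using hr.1
  exact (hpr.trans_eq hpm).trans (hE.trans_eq er.symm)

/-- Closedness is continuity. The growth of `H^{-,i} = E` bounds `s` above, and that of `H^{+,i} ≤
H^i = E` bounds it below. -/
lemma isCompact_criticalSlopes (i : Side) (z₂ p₂ : ℝ) : IsCompact (D.criticalSlopes i z₂ p₂) := by
  have hz : (!₂[0, z₂] : Plane) ∈ interface := by simp [interface]
  obtain ⟨c, C, hc, hg⟩ := hD.exists_growth hz i
  have hvec : Continuous fun s : ℝ => (!₂[s, p₂] : Plane) := by fun_prop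
  have hm : Continuous fun s : ℝ => D.Hminus i !₂[0, z₂] !₂[s, p₂] :=
    (hD.continuous_Hminus hz i).comp hvec
  have hH : Continuous fun s : ℝ => D.H i !₂[0, z₂] !₂[s, p₂] :=
    (hD.continuous_H i).comp (f := fun s : ℝ => ((!₂[0, z₂] : Plane), (!₂[s, p₂] : Plane)))
      (continuous_const.prodMk hvec)
  have hcl : IsClosed (D.criticalSlopes i z₂ p₂) := by
    unfold criticalSlopes
    exact (isClosed_eq hH hm).and (isClosed_eq hm continuous_const)
  refine (isCompact_Icc (a := -((D.E z₂ p₂ + C) / c))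
    (b := (D.E z₂ p₂ + C) / c)).of_isClosed_subset hcl ?_
  rintro p ⟨h1, h2⟩
  have hmax := hD.H_eq_max hz i !₂[p, p₂]
  have hg' := hg (i.sign * p) p₂
  rw [i.sign_mul_sign_mul] at hg'
  have h3 : D.Hplus i !₂[0, z₂] !₂[p, p₂] ≤ D.E z₂ p₂ := by
    exact (le_max_left _ _).trans_eq (hmax.symm.trans (h1.trans h2))
  have h4 : |i.sign * p| ≤ (D.E z₂ p₂ + C) / c := by
    rw [le_div_iff₀ hc]
    rcases abs_cases (i.sign * p) with h | h
    · rw [h.1]; linarith [hg'.2]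
    · rw [h.1]; linarith [hg'.1]
  rw [i.abs_sign_mul] at h4
  exact abs_le.1 h4

/-- The coordinate `s = σ^i p` treats both sides alike: `PiBar` is the critical slope with least
`s`, and `PiHat` the one with greatest `s`. -/
lemma PiBar_mem (i : Side) (z₂ p₂ : ℝ) : D.PiBar i z₂ p₂ ∈ D.criticalSlopes i z₂ p₂ := by
  have h1 := hD.criticalSlopes_nonempty i z₂ p₂
  have h2 := hD.isCompact_criticalSlopes i z₂ p₂
  cases i
  · exact h2.sSup_mem h1
  · exact h2.sInf_mem h1

lemma PiHat_mem (i : Side) (z₂ p₂ : ℝ) : D.PiHat i z₂ p₂ ∈ D.criticalSlopes i z₂ p₂ := by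
  have h1 := hD.criticalSlopes_nonempty i z₂ p₂
  have h2 := hD.isCompact_criticalSlopes i z₂ p₂
  cases i
  · exact h2.sInf_mem h1
  · exact h2.sSup_mem h1

/-- Beyond an admissible slope, `H^{-,i}` is at least `E`. -/
lemma E_le_Hminus {P : Side → ℝ → ℝ → ℝ} (hP : D.IsSlopeSelection P) (i : Side) {z : Plane}
    (hz : z ∈ interface) (p₂ : ℝ) {s : ℝ} (hs : i.sign * P i (z 1) p₂ ≤ s) :
    D.E (z 1) p₂ ≤ D.Hminus i z !₂[i.sign * s, p₂] := by
  have ez : !₂[0, z 1] = z := plane_ext (Eq.symm hz) rfl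
  have hmem := hD.PiBar_mem i (z 1) p₂
  rw [← hmem.2, ez]
  refine hD.Hminus_le_of_le hz ?_ rfl
  simp only [Matrix.cons_val_zero, i.sign_mul_sign_mul]
  refine le_trans ?_ hs
  have h := hP (z 1) p₂
  cases i
  · simp only [Side.sign]; linarith [h.1.2]
  · simp only [Side.sign]; linarith [h.2.1]

/-- At an admissible slope, `H^{+,i}` is at most `E`. -/
lemma Hplus_le_E {P : Side → ℝ → ℝ → ℝ} (hP : D.IsSlopeSelection P) (i : Side) {z : Plane}
    (hz : z ∈ interface) (p₂ : ℝ) : D.Hplus i z !₂[P i (z 1) p₂, p₂] ≤ D.E (z 1) p₂ := by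
  have ez : !₂[0, z 1] = z := plane_ext (Eq.symm hz) rfl
  have hmem := hD.PiBar_mem i (z 1) p₂
  rw [← hmem.2, ← hmem.1, ez]
  refine le_trans ?_ ((le_max_left _ _).trans_eq (hD.H_eq_max hz i _).symm)
  refine hD.Hplus_le_of_le hz ?_ rfl
  have h := hP (z 1) p₂
  simp only [Matrix.cons_val_zero]
  cases i
  · simp only [Side.sign]; linarith [h.1.2]
  · simp only [Side.sign]; linarith [h.2.1]

/-- Up to an admissible slope, `H^{-,i}` is at most `E`. -/
lemma Hminus_le_E {P : Side → ℝ → ℝ → ℝ} (hP : D.IsSlopeSelection P) (i : Side) {z : Plane}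
    (hz : z ∈ interface) (p₂ : ℝ) {s : ℝ} (hs : s ≤ i.sign * P i (z 1) p₂) :
    D.Hminus i z !₂[i.sign * s, p₂] ≤ D.E (z 1) p₂ := by
  have ez : !₂[0, z 1] = z := plane_ext (Eq.symm hz) rfl
  have hmem := hD.PiHat_mem i (z 1) p₂
  rw [← hmem.2, ez]
  refine hD.Hminus_le_of_le hz ?_ rfl
  simp only [Matrix.cons_val_zero, i.sign_mul_sign_mul]
  refine hs.trans ?_
  have h := hP (z 1) p₂
  cases i
  · simp only [Side.sign]; linarith [h.1.1]
  · simp only [Side.sign]; linarith [h.2.2]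

end StandingAssumptions
end ControlData

/-! ### Penalties, separable test functions and localized maxima. -/

/-- The function `t ↦ max(t, 0)²`, a `C¹` penalty that vanishes for `t ≤ 0`. -/
noncomputable def posSq (t : ℝ) : ℝ := max t 0 ^ 2

lemma posSq_nonneg (t : ℝ) : 0 ≤ posSq t := sq_nonneg _

lemma posSq_of_nonpos {t : ℝ} (h : t ≤ 0) : posSq t = 0 := by simp [posSq, h]

lemma posSq_of_nonneg {t : ℝ} (h : 0 ≤ t) : posSq t = t ^ 2 := by simp [posSq, h]

lemma hasDerivAt_posSq (t : ℝ) : HasDerivAt posSq (2 * max t 0) t := by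
  rcases lt_trichotomy t 0 with h | rfl | h
  · rw [max_eq_right h.le, mul_zero]
    refine (hasDerivAt_const t (0 : ℝ)).congr_of_eventuallyEq ?_
    filter_upwards [Iio_mem_nhds h] with s hs using posSq_of_nonpos (le_of_lt hs)
  · rw [max_self, mul_zero]
    rw [hasDerivAt_iff_isLittleO]
    have h1 : (fun x : ℝ => posSq x - posSq 0 - (x - 0) • (0 : ℝ)) =O[𝓝 0] fun x => x ^ 2 := by
      refine Asymptotics.IsBigO.of_bound 1 (Eventually.of_forall fun x => ?_)
      rw [posSq_of_nonpos le_rfl]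
      simp only [smul_zero, sub_zero, one_mul, Real.norm_eq_abs]
      rw [abs_of_nonneg (posSq_nonneg x), abs_of_nonneg (sq_nonneg x)]
      rcases le_total x 0 with hx | hx
      · rw [posSq_of_nonpos hx]; positivity
      · rw [posSq_of_nonneg hx]
    refine h1.trans_isLittleO ?_
    simpa using (Asymptotics.isLittleO_pow_id (𝕜 := ℝ) one_lt_two)
  · rw [max_eq_left h.le]
    have := (hasDerivAt_id t).pow 2
    refine (this.congr_of_eventuallyEq ?_).congr_deriv (by simp)
    filter_upwards [Ioi_mem_nhds h] with s hs using posSq_of_nonneg (le_of_lt hs)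

lemma contDiff_posSq : ContDiff ℝ 1 posSq := by
  rw [contDiff_one_iff_deriv]
  refine ⟨fun t => (hasDerivAt_posSq t).differentiableAt, ?_⟩
  rw [show deriv posSq = fun t => 2 * max t 0 from funext fun t => (hasDerivAt_posSq t).deriv]
  fun_prop

lemma continuous_coord (j : Fin 2) : Continuous fun x : Plane => x j := by fun_prop

/-- The gradient of a separable function. -/
lemma sideGrad_separable {a b : ℝ → ℝ} (ha : ContDiff ℝ 1 a) (hb : ContDiff ℝ 1 b) {i : Side}
    {x : Plane} (hx : x ∈ closedHalfPlane i) :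
    sideGrad (fun y => a (y 0) + b (y 1)) i x = !₂[deriv a (x 0), deriv b (x 1)] := by
  have ha' := ha.differentiable (by norm_num)
  have hb' := hb.differentiable (by norm_num)
  refine sideGrad_eq_of_hasDerivAt ?_ hx ?_ ?_
  · have h0 : DifferentiableAt ℝ (fun y : Plane => y 0) x := by fun_prop
    have h1 : DifferentiableAt ℝ (fun y : Plane => y 1) x := by fun_prop
    exact ((ha' (x 0)).comp x h0).add ((hb' (x 1)).comp x h1)
  · exact (show HasDerivAt (fun t => a t + b (x 1)) (deriv a (x 0)) (x 0) from
      (ha' (x 0)).hasDerivAt.add_const _)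
  · exact (show HasDerivAt (fun t => a (x 0) + b t) (deriv b (x 1)) (x 1) from
      (hb' (x 1)).hasDerivAt.const_add _)

lemma contDiff_separable {a b : ℝ → ℝ} (ha : ContDiff ℝ 1 a) (hb : ContDiff ℝ 1 b) :
    ContDiff ℝ 1 fun y : Plane => a (y 0) + b (y 1) :=
  (ha.comp (EuclideanSpace.proj (𝕜 := ℝ) (0 : Fin 2)).contDiff).add
    (hb.comp (EuclideanSpace.proj (𝕜 := ℝ) (1 : Fin 2)).contDiff)

lemma exists_rect_of_eventually {z : Plane} {Q : Plane → Prop} (h : ∀ᶠ x in 𝓝 z, Q x) :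
    ∃ r : ℝ, 0 < r ∧ ∀ x : Plane, |x 0 - z 0| ≤ r → |x 1 - z 1| ≤ r → Q x := by
  have hmap : Continuous fun q : ℝ × ℝ => (!₂[q.1, q.2] : Plane) := by fun_prop
  have ht := hmap.tendsto (z 0, z 1)
  simp only [eta_plane] at ht
  obtain ⟨r, hr, hQ⟩ := Metric.eventually_nhds_iff.1 (ht.eventually h)
  refine ⟨r / 2, by positivity, fun x h0 h1 => ?_⟩
  rw [← eta_plane x]
  refine hQ (y := (x 0, x 1)) ?_
  rw [Prod.dist_eq, Real.dist_eq, Real.dist_eq]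
  exact max_lt (by simp only; linarith) (by simp only; linarith)

lemma eventually_abs_sub_lt {f : Plane → ℝ} (hf : Continuous f) (z : Plane) {η : ℝ} (hη : 0 < η) :
    ∀ᶠ x in 𝓝 z, |f x - f z| < η := by
  have := (hf.tendsto z).eventually (Metric.ball_mem_nhds _ hη)
  filter_upwards [this] with x hx using by rwa [← Real.dist_eq]

/-- The half-rectangle of `Ω̄^i` with half-width `r` around the point `(0, z₂)`. -/
def halfRect (i : Side) (z : Plane) (r : ℝ) : Set Plane :=
  {x | 0 ≤ i.sign * x 0 ∧ i.sign * x 0 ≤ r ∧ |x 1 - z 1| ≤ r}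

lemma isCompact_halfRect (i : Side) (z : Plane) (r : ℝ) : IsCompact (halfRect i z r) := by
  have hmap : Continuous fun q : ℝ × ℝ => (!₂[q.1, q.2] : Plane) := by fun_prop
  have hc : IsCompact ((fun q : ℝ × ℝ => (!₂[q.1, q.2] : Plane)) ''
      (Set.Icc (-r) r ×ˢ Set.Icc (z 1 - r) (z 1 + r))) :=
    (isCompact_Icc.prod isCompact_Icc).image hmap
  refine hc.of_isClosed_subset ?_ ?_
  · have c0 := continuous_coord 0
    have c1 := continuous_coord 1
    exact (isClosed_le continuous_const (continuous_const.mul c0)).and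
      ((isClosed_le (continuous_const.mul c0) continuous_const).and
        (isClosed_le (c1.sub continuous_const).abs continuous_const))
  · rintro x ⟨h0, h1, h2⟩
    refine ⟨(x 0, x 1), ⟨?_, ?_⟩, eta_plane x⟩
    · refine abs_le.1 ?_
      simp only
      rw [← i.abs_sign_mul, abs_of_nonneg h0]
      exact h1
    · have := abs_le.1 h2
      exact ⟨by simp only; linarith [this.1], by simp only; linarith [this.2]⟩

/-- A function that is smaller on the boundary of a half-rectangle than at one of its points has
an interior local maximum. -/
lemma exists_isLocalMax_of_halfRect {w : Plane → ℝ} (hw : UpperSemicontinuous w) {i : Side}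
    {z x' : Plane} {r : ℝ} (hx' : x' ∈ halfRect i z r)
    (hbd : ∀ x ∈ halfRect i z r, i.sign * x 0 = 0 ∨ i.sign * x 0 = r ∨ |x 1 - z 1| = r →
      w x < w x') :
    ∃ x ∈ halfRect i z r, x ∈ halfPlane i ∧ IsLocalMax w x ∧ w x' ≤ w x := by
  obtain ⟨x, hx, hmax⟩ := UpperSemicontinuousOn.exists_isMaxOn ⟨x', hx'⟩
    (isCompact_halfRect i z r) (hw.upperSemicontinuousOn _)
  have hle : w x' ≤ w x := hmax hx'
  have hne : ¬ (i.sign * x 0 = 0 ∨ i.sign * x 0 = r ∨ |x 1 - z 1| = r) := fun h =>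
    (hbd x hx h).not_ge hle
  push Not at hne
  have h0 : 0 < i.sign * x 0 := lt_of_le_of_ne hx.1 (Ne.symm hne.1)
  have h1 : i.sign * x 0 < r := lt_of_le_of_ne hx.2.1 hne.2.1
  have h2 : |x 1 - z 1| < r := lt_of_le_of_ne hx.2.2 hne.2.2
  refine ⟨x, hx, h0, hmax.isLocalMax ?_, hle⟩
  have c0 := (continuous_coord 0).const_smul i.sign
  have c1 := ((continuous_coord 1).sub (continuous_const (y := z 1))).abs
  filter_upwards [(c0.tendsto x).eventually (lt_mem_nhds h0),
    (c0.tendsto x).eventually (gt_mem_nhds h1), (c1.tendsto x).eventually (gt_mem_nhds h2)]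
    with y y0 y1 y2 using ⟨y0.le, y1.le, y2.le⟩

/-! ### Slopes touching from above, and passage of the equation to the boundary. -/

/-- Locally in `Ω̄^i`, `v` is below the function `ψ(x₂) + s |x₁|` translated so as to touch `v` at
`z ∈ Γ`. -/
def TouchesAbove (v : Plane → ℝ) (ψ : ℝ → ℝ) (i : Side) (z : Plane) (s : ℝ) : Prop :=
  ∀ᶠ x in 𝓝 z, 0 ≤ i.sign * x 0 → v x - ψ (x 1) - s * (i.sign * x 0) ≤ v z - ψ (z 1)

lemma TouchesAbove.mono {v : Plane → ℝ} {ψ : ℝ → ℝ} {i : Side} {z : Plane} {s t : ℝ}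
    (h : TouchesAbove v ψ i z s) (hst : s ≤ t) : TouchesAbove v ψ i z t := by
  filter_upwards [h] with x hx h0
  have := mul_le_mul_of_nonneg_right hst h0
  linarith [hx h0]

/-- The touching slopes form an up-set, and `c` is its infimum. It need not be touching itself,
hence the formulation with `c ± ε`. -/
lemma exists_critical_slope {v : Plane → ℝ} {ψ : ℝ → ℝ} {i : Side} {z : Plane} {s t : ℝ}
    (ht : TouchesAbove v ψ i z t) (hs : ¬ TouchesAbove v ψ i z s) :
    ∃ c, s ≤ c ∧ (∀ t, TouchesAbove v ψ i z t → c ≤ t) ∧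
      (∀ ε > 0, TouchesAbove v ψ i z (c + ε)) ∧ ∀ ε > 0, ¬ TouchesAbove v ψ i z (c - ε) := by
  have hlow : ∀ r ∈ {r | TouchesAbove v ψ i z r}, s ≤ r := fun r hr => by
    by_contra! h
    exact hs (TouchesAbove.mono hr h.le)
  have hbdd : BddBelow {r | TouchesAbove v ψ i z r} := ⟨s, hlow⟩
  refine ⟨sInf {r | TouchesAbove v ψ i z r}, le_csInf ⟨t, ht⟩ hlow, fun r hr => csInf_le hbdd hr,
    fun ε hε => ?_, fun ε hε h => ?_⟩
  · obtain ⟨r, hr, hlt⟩ := exists_lt_of_csInf_lt ⟨t, ht⟩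
      (lt_add_of_pos_right (sInf {r | TouchesAbove v ψ i z r}) hε)
    exact TouchesAbove.mono hr hlt.le
  · have := csInf_le hbdd h
    linarith

/-- `v` satisfies `lam v + F(x, Dv) ≤ 0` in `Ω^i`, tested with separable functions. -/
def IsSeparableSubsolution (v : Plane → ℝ) (F : Plane → Plane → ℝ) (lam : ℝ) (i : Side) : Prop :=
  ∀ x ∈ halfPlane i, ∀ a b : ℝ → ℝ, ContDiff ℝ 1 a → ContDiff ℝ 1 b →
    IsLocalMax (fun y => v y - (a (y 0) + b (y 1))) x →
    lam * v x + F x !₂[deriv a (x 0), deriv b (x 1)] ≤ 0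

lemma upperSemicontinuous_sub_separable {v : Plane → ℝ} (hv : UpperSemicontinuous v)
    {a b : ℝ → ℝ} (ha : ContDiff ℝ 1 a) (hb : ContDiff ℝ 1 b) :
    UpperSemicontinuous fun y => v y - (a (y 0) + b (y 1)) := by
  have h := hv.add (contDiff_separable ha hb).continuous.neg.upperSemicontinuous
  exact h

section Slopes

variable {v : Plane → ℝ} {F : Plane → Plane → ℝ} {lam : ℝ} {i : Side} {ψ : ℝ → ℝ} {z : Plane}
  {s : ℝ}

/-- At the critical slope, the equation in `Ω^i` passes to the limit at the boundary point `z`. -/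
theorem le_zero_of_critical_slope (hlam : 0 ≤ lam) (hz : z 0 = 0) (hv : UpperSemicontinuous v)
    (hψ : ContDiff ℝ 1 ψ)
    (hF : ContinuousAt (fun q : Plane × Plane => F q.1 q.2) (z, !₂[i.sign * s, deriv ψ (z 1)]))
    (hsub : IsSeparableSubsolution v F lam i)
    (hup : ∀ ε > 0, TouchesAbove v ψ i z (s + ε))
    (hdown : ∀ ε > 0, ¬ TouchesAbove v ψ i z (s - ε)) :
    lam * v z + F z !₂[i.sign * s, deriv ψ (z 1)] ≤ 0 := by
  by_contra! hX
  set X := lam * v z + F z !₂[i.sign * s, deriv ψ (z 1)] with hXdef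
  -- Error budget: the interior maximum loses at most `2κ` in `v` (from `ψ` and from the linear
  -- term) and `κ` in `F`.
  obtain ⟨κ, hκ, hκX⟩ : ∃ κ : ℝ, 0 < κ ∧ κ * (2 * lam + 2) = X :=
    ⟨X / (2 * lam + 2), by positivity, by field_simp⟩
  have hF' := hF.eventually (lt_mem_nhds (sub_lt_self (F z !₂[i.sign * s, deriv ψ (z 1)]) hκ))
  rw [nhds_prod_eq, eventually_prod_iff] at hF'
  obtain ⟨pa, hpa, pb, hpb, hFab⟩ := hF'
  obtain ⟨η, hη, hpb'⟩ := exists_rect_of_eventually hpb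
  simp only [Matrix.cons_val_zero, Matrix.cons_val_one] at hpb'
  -- Penalty derivatives will be at most `9ε`, and `9/20 < 1/2` leaves room for the `η/2` variation
  -- of `ψ'`.
  set ε := η / 20 with hε
  have hε0 : 0 < ε := by positivity
  have hψ1 : Continuous fun x : Plane => ψ (x 1) := hψ.continuous.comp (continuous_coord 1)
  have hψ2 : Continuous fun x : Plane => deriv ψ (x 1) :=
    (hψ.continuous_deriv le_rfl).comp (continuous_coord 1)
  have hlin : Continuous fun x : Plane => (s - ε) * (i.sign * x 0) :=
    continuous_const.mul (continuous_const.mul (continuous_coord 0))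
  obtain ⟨r, hr, hrect⟩ := exists_rect_of_eventually (hpa.and
    ((eventually_abs_sub_lt hψ1 z hκ).and ((eventually_abs_sub_lt hψ2 z (half_pos hη)).and
      ((eventually_abs_sub_lt hlin z hκ).and (hup ε hε0)))))
  have hmem : ∀ x ∈ halfRect i z r, |x 0 - z 0| ≤ r := fun x hx => by
    rw [hz, sub_zero, ← i.abs_sign_mul, abs_of_nonneg hx.1]; exact hx.2.1
  -- On the outer edges the penalty is at least `N(r/2)² = 9εr/4`, beating the gain `2εr` due to the
  -- gap between the slopes `s - ε` and `s + ε`; its derivative stays below `Nr = 9ε`.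
  set N := 9 * ε / r with hN
  have hN0 : 0 < N := by positivity
  have hNr : N * r = 9 * ε := by rw [hN]; field_simp
  set a : ℝ → ℝ := fun t => (s - ε) * (i.sign * t) + N * posSq (i.sign * t - r / 2) with ha
  set b : ℝ → ℝ := fun t => ψ t + N * (posSq (t - z 1 - r / 2) + posSq (z 1 - t - r / 2)) with hb
  have haC : ContDiff ℝ 1 a := by
    have h1 : ContDiff ℝ 1 fun t : ℝ => i.sign * t := contDiff_const.mul contDiff_id
    exact (contDiff_const.mul h1).add
      (contDiff_const.mul (contDiff_posSq.comp (h1.sub contDiff_const)))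
  have hbC : ContDiff ℝ 1 b := by
    refine hψ.add (contDiff_const.mul ((contDiff_posSq.comp ?_).add (contDiff_posSq.comp ?_)))
    · exact (contDiff_id.sub contDiff_const).sub contDiff_const
    · exact (contDiff_const.sub contDiff_id).sub contDiff_const
  -- A point where slope `s - ε` fails to touch, taken in the inner half of the rectangle where the
  -- penalties vanish. It beats all boundary values, including those on `Γ`.
  obtain ⟨x', hx'v, hx'0, hx'1⟩ := ((not_eventually.1 (hdown ε hε0)).and_eventually
    ((eventually_abs_sub_lt (continuous_coord 0) z (half_pos hr)).and
      (eventually_abs_sub_lt (continuous_coord 1) z (half_pos hr)))).exists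
  push Not at hx'v
  obtain ⟨hx's, hx'v⟩ := hx'v
  rw [hz, sub_zero, ← i.abs_sign_mul, abs_of_nonneg hx's] at hx'0
  have hx'abs := abs_lt.1 hx'1
  have hwx' : v z - ψ (z 1) < v x' - (a (x' 0) + b (x' 1)) := by
    simp only [ha, hb]
    rw [posSq_of_nonpos (by linarith), posSq_of_nonpos (by linarith [hx'abs.2]),
      posSq_of_nonpos (by linarith [hx'abs.1])]
    linarith
  have hle : ∀ x ∈ halfRect i z r, v x - (a (x 0) + b (x 1)) ≤ v z - ψ (z 1) +
      2 * ε * (i.sign * x 0) - N * (posSq (i.sign * x 0 - r / 2) +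
        (posSq (x 1 - z 1 - r / 2) + posSq (z 1 - x 1 - r / 2))) := fun x hx => by
    have := (hrect x (hmem x hx) hx.2.2).2.2.2.2 hx.1
    simp only [ha, hb]
    linarith
  have hedge : 2 * ε * r < N * (r / 2) ^ 2 := by
    have : N * (r / 2) ^ 2 = 9 * ε * r / 4 := by rw [← hNr]; ring
    rw [this]; nlinarith [mul_pos hε0 hr]
  obtain ⟨x, hx, hxi, hmax, hge⟩ := exists_isLocalMax_of_halfRect
    (upperSemicontinuous_sub_separable hv haC hbC) (i := i) (z := z) (x' := x') (r := r)
    ⟨hx's, by linarith, by linarith⟩ (fun x hx hxb => by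
      refine lt_of_le_of_lt (hle x hx) (lt_of_le_of_lt ?_ hwx')
      have q0 := mul_nonneg hN0.le (posSq_nonneg (i.sign * x 0 - r / 2))
      have q1 := mul_nonneg hN0.le (posSq_nonneg (x 1 - z 1 - r / 2))
      have q2 := mul_nonneg hN0.le (posSq_nonneg (z 1 - x 1 - r / 2))
      have q3 : 2 * ε * (i.sign * x 0) ≤ 2 * ε * r :=
        mul_le_mul_of_nonneg_left hx.2.1 (by positivity)
      rw [mul_add, mul_add]
      rcases hxb with h | h | h
      · rw [h, mul_zero]; rw [h] at q0; linarith
      · have : posSq (i.sign * x 0 - r / 2) = (r / 2) ^ 2 := by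
          rw [h, posSq_of_nonneg (by linarith)]; ring
        rw [this]; linarith
      · rcases abs_choice (x 1 - z 1) with h' | h'
        · have : posSq (x 1 - z 1 - r / 2) = (r / 2) ^ 2 := by
            rw [← h', h, posSq_of_nonneg (by linarith)]; ring
          rw [this]; linarith
        · have : posSq (z 1 - x 1 - r / 2) = (r / 2) ^ 2 := by
            rw [← neg_sub (x 1), ← h', h, posSq_of_nonneg (by linarith)]; ring
          rw [this]; linarith)
  obtain ⟨hxa, hxψ, hxψ', hxlin, -⟩ := hrect x (hmem x hx) hx.2.2
  have hda : deriv a (x 0) = i.sign * (s - ε + N * (2 * max (i.sign * x 0 - r / 2) 0)) := by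
    have h1 : HasDerivAt (fun t : ℝ => i.sign * t) i.sign (x 0) := by
      simpa using (hasDerivAt_id (x 0)).const_mul i.sign
    have h2 := (h1.const_mul (s - ε)).add
      (((hasDerivAt_posSq (i.sign * x 0 - r / 2)).comp (x 0) (h1.sub_const (r / 2))).const_mul N)
    exact (h2.congr_deriv (by ring)).deriv
  have hdb : deriv b (x 1) = deriv ψ (x 1) +
      N * (2 * max (x 1 - z 1 - r / 2) 0 - 2 * max (z 1 - x 1 - r / 2) 0) := by
    have h1 : HasDerivAt (fun t : ℝ => t - z 1 - r / 2) 1 (x 1) :=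
      ((hasDerivAt_id (x 1)).sub_const _).sub_const _
    have h2 : HasDerivAt (fun t : ℝ => z 1 - t - r / 2) (-1) (x 1) :=
      ((hasDerivAt_id (x 1)).const_sub _).sub_const _
    have h3 := ((hψ.differentiable (by norm_num) (x 1)).hasDerivAt).add
      ((((hasDerivAt_posSq _).comp (x 1) h1).add ((hasDerivAt_posSq _).comp (x 1) h2)).const_mul N)
    exact (h3.congr_deriv (by ring)).deriv
  have hmaxle : ∀ t, t ≤ r → 0 ≤ N * (2 * max (t - r / 2) 0) ∧
      N * (2 * max (t - r / 2) 0) ≤ 9 * ε := fun t ht => by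
    have h0 : 0 ≤ max (t - r / 2) 0 := le_max_right _ _
    have h1 : max (t - r / 2) 0 ≤ r / 2 := max_le (by linarith) (by linarith)
    refine ⟨by positivity, ?_⟩
    rw [← hNr]
    exact mul_le_mul_of_nonneg_left (by linarith) hN0.le
  have hx1 := abs_le.1 hx.2.2
  have hpbx : pb !₂[deriv a (x 0), deriv b (x 1)] := by
    refine hpb' _ ?_ ?_
    · simp only [Matrix.cons_val_zero]
      rw [hda, ← mul_sub, i.abs_sign_mul, abs_le]
      have := hmaxle _ hx.2.1
      constructor <;> linarith [this.1, this.2]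
    · simp only [Matrix.cons_val_zero, Matrix.cons_val_one]
      rw [hdb, abs_le]
      have h1 := hmaxle (x 1 - z 1) (by linarith [hx1.2])
      have h2 := hmaxle (z 1 - x 1) (by linarith [hx1.1])
      have h3 := abs_lt.1 hxψ'
      rw [mul_sub]
      constructor <;> linarith [h1.1, h1.2, h2.1, h2.2, h3.1, h3.2]
  have hfin := hsub x hxi a b haC hbC hmax
  have hFx := hFab hxa hpbx
  simp only at hFx
  have hvx : v z - 2 * κ ≤ v x := by
    have q0 := mul_nonneg hN0.le (posSq_nonneg (i.sign * x 0 - r / 2))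
    have q1 := mul_nonneg hN0.le (posSq_nonneg (x 1 - z 1 - r / 2))
    have q2 := mul_nonneg hN0.le (posSq_nonneg (z 1 - x 1 - r / 2))
    have h1 := (abs_lt.1 hxψ).1
    have h2 := (abs_lt.1 hxlin).1
    rw [hz, mul_zero, mul_zero] at h2
    have h3 : v z - ψ (z 1) < v x - (a (x 0) + b (x 1)) := hwx'.trans_le hge
    simp only [ha, hb] at h3
    linarith
  have := mul_le_mul_of_nonneg_left hvx hlam
  linarith

/-- If `v` does not jump on `Γ`, then the equation in `Ω^i` with a Hamiltonian that is monotone in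
the normal slope passes to the limit on `Γ`. -/
theorem le_zero_of_touchesAbove (hlam : 0 ≤ lam) (hz : z 0 = 0) (hv : UpperSemicontinuous v)
    (hψ : ContDiff ℝ 1 ψ)
    (hF : ContinuousAt (fun q : Plane × Plane => F q.1 q.2) (z, !₂[i.sign * s, deriv ψ (z 1)]))
    (hmono : ∀ᶠ x in 𝓝 z, ∀ p q : Plane, p 1 = q 1 → i.sign * q 0 ≤ i.sign * p 0 → F x p ≤ F x q)
    (hsub : IsSeparableSubsolution v F lam i) (htouch : TouchesAbove v ψ i z s)
    (hjump : ∀ c < v z, ∃ᶠ x in 𝓝[halfPlane i] z, c < v x) :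
    lam * v z + F z !₂[i.sign * s, deriv ψ (z 1)] ≤ 0 := by
  by_contra! hX
  set X := lam * v z + F z !₂[i.sign * s, deriv ψ (z 1)] with hXdef
  -- Three losses of `κ` in `v` this time: from `ψ`, the linear term and the margin `r²/2 ≤ κ`.
  obtain ⟨κ, hκ, hκX⟩ : ∃ κ : ℝ, 0 < κ ∧ κ * (3 * lam + 2) = X :=
    ⟨X / (3 * lam + 2), by positivity, by field_simp⟩
  have hF' := hF.eventually (lt_mem_nhds (sub_lt_self (F z !₂[i.sign * s, deriv ψ (z 1)]) hκ))
  rw [nhds_prod_eq, eventually_prod_iff] at hF'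
  obtain ⟨pa, hpa, pb, hpb, hFab⟩ := hF'
  obtain ⟨η, hη, hpb'⟩ := exists_rect_of_eventually hpb
  simp only [Matrix.cons_val_zero, Matrix.cons_val_one] at hpb'
  have hψ1 : Continuous fun x : Plane => ψ (x 1) := hψ.continuous.comp (continuous_coord 1)
  have hψ2 : Continuous fun x : Plane => deriv ψ (x 1) :=
    (hψ.continuous_deriv le_rfl).comp (continuous_coord 1)
  have hlin : Continuous fun x : Plane => s * (i.sign * x 0) :=
    continuous_const.mul (continuous_const.mul (continuous_coord 0))
  obtain ⟨r₀, hr₀, hrect⟩ := exists_rect_of_eventually (hpa.and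
    ((eventually_abs_sub_lt hψ1 z hκ).and ((eventually_abs_sub_lt hψ2 z (half_pos hη)).and
      ((eventually_abs_sub_lt hlin z hκ).and (htouch.and hmono)))))
  obtain ⟨r, hr, hrr₀, hrη, hr1, hrκ⟩ : ∃ r : ℝ, 0 < r ∧ r ≤ r₀ ∧ r ≤ η / 4 ∧ r ≤ 1 ∧ r ≤ κ :=
    ⟨min (min r₀ (η / 4)) (min 1 κ), by positivity, (min_le_left _ _).trans (min_le_left _ _),
      (min_le_left _ _).trans (min_le_right _ _), (min_le_right _ _).trans (min_le_left _ _),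
      (min_le_right _ _).trans (min_le_right _ _)⟩
  have hmem : ∀ x ∈ halfRect i z r, |x 0| ≤ r := fun x hx => by
    rw [← i.abs_sign_mul, abs_of_nonneg hx.1]; exact hx.2.1
  have hrect' := fun x (hx : x ∈ halfRect i z r) => hrect x
    (by rw [hz, sub_zero]; exact (hmem x hx).trans hrr₀) (hx.2.2.trans hrr₀)
  have hr2 : 0 < r ^ 2 / 8 := by positivity
  have hquad : Continuous fun x : Plane => x 0 ^ 2 + (x 1 - z 1) ^ 2 :=
    ((continuous_coord 0).pow 2).add (((continuous_coord 1).sub continuous_const).pow 2)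
  -- The absence of a jump provides `x'` inside `Ω^i`. Four errors of `r²/8` (in `v`, `ψ`, the
  -- linear and the quadratic terms) add up to the margin `r²/2`.
  obtain ⟨x', hx'v, ⟨hx'0, hx'1, hx'ψ, hx'lin, hx'q⟩, hx'i⟩ :=
    ((hjump (v z - r ^ 2 / 8) (by linarith)).and_eventually
      ((Eventually.filter_mono nhdsWithin_le_nhds ((eventually_abs_sub_lt (continuous_coord 0) z hr).and
        ((eventually_abs_sub_lt (continuous_coord 1) z hr).and ((eventually_abs_sub_lt hψ1 z hr2).and
        ((eventually_abs_sub_lt hlin z hr2).and (eventually_abs_sub_lt hquad z hr2)))))).and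
        self_mem_nhdsWithin)).exists
  have hT : 0 < i.sign * x' 0 := hx'i
  set T := i.sign * x' 0 with hTdef
  rw [hz, sub_zero, ← i.abs_sign_mul, abs_of_pos hT] at hx'0
  simp only [hz, mul_zero, sub_zero, sub_self] at hx'lin hx'q
  -- The penalty vanishes at `x'` and equals `r²` on `Γ`, so it repels the maximum from `Γ`.
  set N := r ^ 2 / T ^ 2 with hN
  have hN0 : 0 < N := by positivity
  have hNT : N * T ^ 2 = r ^ 2 := by rw [hN]; field_simp
  set a : ℝ → ℝ := fun t => s * (i.sign * t) + t ^ 2 + N * posSq (T - i.sign * t) with ha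
  set b : ℝ → ℝ := fun t => ψ t + (t - z 1) ^ 2 with hb
  have haC : ContDiff ℝ 1 a := by
    have h1 : ContDiff ℝ 1 fun t : ℝ => i.sign * t := contDiff_const.mul contDiff_id
    exact ((contDiff_const.mul h1).add (contDiff_id.pow 2)).add
      (contDiff_const.mul (contDiff_posSq.comp (contDiff_const.sub h1)))
  have hbC : ContDiff ℝ 1 b := hψ.add ((contDiff_id.sub contDiff_const).pow 2)
  have hwx' : v z - ψ (z 1) - r ^ 2 / 2 < v x' - (a (x' 0) + b (x' 1)) := by
    simp only [ha, hb]
    rw [← hTdef, sub_self, posSq_of_nonpos le_rfl]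
    have h1 := (abs_lt.1 hx'ψ).2
    have h2 := (abs_lt.1 hx'lin).2
    have h3 := (abs_lt.1 hx'q).2
    norm_num at h3
    linarith
  have hle : ∀ x ∈ halfRect i z r, v x - (a (x 0) + b (x 1)) ≤ v z - ψ (z 1) -
      (x 0 ^ 2 + (x 1 - z 1) ^ 2 + N * posSq (T - i.sign * x 0)) := fun x hx => by
    have := (hrect' x hx).2.2.2.2.1 hx.1
    simp only [ha, hb]
    linarith
  obtain ⟨x, hx, hxi, hmax, hge⟩ := exists_isLocalMax_of_halfRect
    (upperSemicontinuous_sub_separable hv haC hbC) (i := i) (z := z) (x' := x') (r := r)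
    ⟨hT.le, hx'0.le, hx'1.le⟩ (fun x hx hxb => by
      refine lt_of_le_of_lt (hle x hx) (lt_of_le_of_lt ?_ hwx')
      have q0 := mul_nonneg hN0.le (posSq_nonneg (T - i.sign * x 0))
      have q1 := sq_nonneg (x 0)
      have q2 := sq_nonneg (x 1 - z 1)
      rcases hxb with h | h | h
      · have : N * posSq (T - i.sign * x 0) = r ^ 2 := by
          rw [h, sub_zero, posSq_of_nonneg hT.le, hNT]
        linarith
      · have : x 0 ^ 2 = r ^ 2 := by
          rw [← h]; linear_combination -(x 0 ^ 2) * i.sign_mul_self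
        linarith
      · have : (x 1 - z 1) ^ 2 = r ^ 2 := by rw [← h, sq_abs]
        linarith)
  obtain ⟨hxa, hxψ, hxψ', hxlin, -, hxmono⟩ := hrect' x hx
  have hda : deriv a (x 0) =
      i.sign * s + 2 * x 0 - i.sign * (N * (2 * max (T - i.sign * x 0) 0)) := by
    have h1 : HasDerivAt (fun t : ℝ => i.sign * t) i.sign (x 0) := by
      simpa using (hasDerivAt_id (x 0)).const_mul i.sign
    have h2 := ((h1.const_mul s).add ((hasDerivAt_id (x 0)).pow 2)).add
      (((hasDerivAt_posSq (T - i.sign * x 0)).comp (x 0) (h1.const_sub T)).const_mul N)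
    refine (h2.congr_deriv ?_).deriv
    simp only [id]
    ring
  have hdb : deriv b (x 1) = deriv ψ (x 1) + 2 * (x 1 - z 1) := by
    have h3 := ((hψ.differentiable (by norm_num) (x 1)).hasDerivAt).add
      (((hasDerivAt_id (x 1)).sub_const (z 1)).pow 2)
    refine (h3.congr_deriv ?_).deriv
    simp
  have hFx : F z !₂[i.sign * s, deriv ψ (z 1)] - κ <
      F x !₂[i.sign * s + 2 * x 0, deriv b (x 1)] := by
    refine hFab hxa (hpb' _ ?_ ?_)
    · simp only [Matrix.cons_val_zero]
      rw [add_sub_cancel_left, abs_mul, abs_two]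
      linarith [hmem x hx]
    · simp only [Matrix.cons_val_zero, Matrix.cons_val_one]
      rw [hdb, abs_le]
      have h3 := abs_lt.1 hxψ'
      have h4 := abs_le.1 hx.2.2
      constructor <;> linarith [h3.1, h3.2, h4.1, h4.2]
  have hfin := hsub x hxi a b haC hbC hmax
  -- The derivative of this penalty is not controlled as `T → 0`, but it lowers the slope `s`, which
  -- can only increase `F`; it can be dropped.
  have hFm := hxmono !₂[i.sign * s + 2 * x 0, deriv b (x 1)] !₂[deriv a (x 0), deriv b (x 1)] rfl (by
    simp only [Matrix.cons_val_zero]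
    rw [hda, mul_sub, i.sign_mul_sign_mul]
    have : 0 ≤ max (T - i.sign * x 0) 0 := le_max_right _ _
    have : 0 ≤ N * (2 * max (T - i.sign * x 0) 0) := by positivity
    linarith)
  have hvx : v z - 3 * κ ≤ v x := by
    have q0 := mul_nonneg hN0.le (posSq_nonneg (T - i.sign * x 0))
    have q1 := sq_nonneg (x 0)
    have q2 := sq_nonneg (x 1 - z 1)
    have h1 := (abs_lt.1 hxψ).1
    have h2 := (abs_lt.1 hxlin).1
    rw [hz, mul_zero, mul_zero] at h2
    have h3 : v z - ψ (z 1) - r ^ 2 / 2 < v x - (a (x 0) + b (x 1)) := hwx'.trans_le hge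
    simp only [ha, hb] at h3
    have h4 : r ^ 2 ≤ κ := by nlinarith
    linarith
  have := mul_le_mul_of_nonneg_left hvx hlam
  linarith

end Slopes

/-! ### Traces and one-sided slopes of test functions; the reduced test functions. -/

section TestFunctions

variable {φ : Plane → ℝ} {z : Plane}

lemma IsTestFunction.hasFDerivWithinAt (hφ : IsTestFunction φ) (i : Side) {x : Plane}
    (hx : x ∈ closedHalfPlane i) :
    HasFDerivWithinAt φ (fderivWithin ℝ φ (closedHalfPlane i) x) (closedHalfPlane i) x :=
  ((hφ.2 i).differentiableOn (by norm_num) x hx).hasFDerivWithinAt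

lemma IsTestFunction.neg (hφ : IsTestFunction φ) : IsTestFunction fun x => -φ x :=
  ⟨hφ.1.neg, fun i => (hφ.2 i).neg⟩

lemma IsTestFunction.sideGrad_neg (hφ : IsTestFunction φ) {i : Side} {x : Plane}
    (hx : x ∈ closedHalfPlane i) : sideGrad (fun x => -φ x) i x = -sideGrad φ i x := by
  rw [sideGrad_eq_of_hasFDerivWithinAt (hφ.hasFDerivWithinAt i hx) hx,
    sideGrad_eq_of_hasFDerivWithinAt (hφ.hasFDerivWithinAt i hx).fun_neg hx]
  exact plane_ext (by simp) (by simp)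

/-- The trace of a test function on the interface is `C¹`. -/
lemma IsTestFunction.contDiff_trace (hφ : IsTestFunction φ) :
    ContDiff ℝ 1 fun t : ℝ => φ !₂[0, t] := by
  have hline : ContDiff ℝ 1 fun t : ℝ => (!₂[0, t] : Plane) := by
    have e : (fun t : ℝ => (!₂[0, t] : Plane)) = fun t => t • !₂[0, 1] := by
      funext t; refine plane_ext ?_ ?_ <;> simp
    rw [e]
    exact contDiff_id.smul contDiff_const
  have h := (hφ.2 Side.R).comp (s := Set.univ) hline.contDiffOn fun t _ => by
    simp [closedHalfPlane]
  exact contDiffOn_univ.1 h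

/-- `Γ` lies in both closed half-planes, so the two side gradients share their tangential component,
the derivative of the trace. -/
lemma IsTestFunction.deriv_trace (hφ : IsTestFunction φ) (hz : z ∈ interface) (i : Side) :
    deriv (fun t : ℝ => φ !₂[0, t]) (z 1) = sideGrad φ i z 1 := by
  have hzi := interface_subset_closedHalfPlane i hz
  have ez : !₂[0, z 1] = z := plane_ext (Eq.symm hz) rfl
  rw [sideGrad_eq_of_hasFDerivWithinAt (hφ.hasFDerivWithinAt i hzi) hzi]
  have h := hφ.hasFDerivWithinAt i hzi
  have h' := h.comp_hasDerivAt_of_eq (z 1) (hasDerivAt_line_snd 0 (z 1))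
    (Eventually.of_forall fun t => by simp [closedHalfPlane]) ez.symm
  exact h'.deriv

lemma tangentialDeriv_eq (hz : z ∈ interface) :
    tangentialDeriv φ z = deriv (fun t : ℝ => φ !₂[0, t]) (z 1) := by
  have hz0 : z 0 = 0 := hz
  rw [tangentialDeriv, hz0]

/-- A test function grows away from the interface at most at a rate close to its normal
derivative. -/
lemma IsTestFunction.touchesAbove (hφ : IsTestFunction φ) (hz : z ∈ interface) {v : Plane → ℝ}
    (hmax : IsLocalMax (fun x => v x - φ x) z) (i : Side) {ε : ℝ} (hε : 0 < ε) :
    TouchesAbove v (fun t => φ !₂[0, t]) i z (i.sign * sideGrad φ i z 0 + ε) := by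
  have hzi := interface_subset_closedHalfPlane i hz
  have ez : !₂[0, z 1] = z := plane_ext (Eq.symm hz) rfl
  set L := fderivWithin ℝ φ (closedHalfPlane i) with hL
  have hgrad : sideGrad φ i z 0 = L z !₂[1, 0] := by
    rw [sideGrad_eq_of_hasFDerivWithinAt (hφ.hasFDerivWithinAt i hzi) hzi]; rfl
  have hcont : ContinuousOn L (closedHalfPlane i) :=
    (hφ.2 i).continuousOn_fderivWithin (uniqueDiffOn_closedHalfPlane i) le_rfl
  obtain ⟨r, hr, hLr⟩ := Metric.continuousWithinAt_iff.1 (hcont z hzi) ε hε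
  have hproj : Continuous fun x : Plane => (!₂[0, x 1] : Plane) := by fun_prop
  have hball := Metric.ball_mem_nhds z hr
  have hball' := (hproj.tendsto z).eventually (by rw [ez]; exact hball)
  filter_upwards [hmax, hball, hball'] with x hx hxb hxb' hxs
  -- Mean value inequality on the normal segment from `(0, x₂)` to `x`, inside a convex set where
  -- the one-sided derivative stays within `ε` of its value at `z`.
  have key := ((convex_closedHalfPlane i).inter
    (convex_ball z r)).norm_image_sub_le_of_norm_hasFDerivWithin_le' (f := φ) (f' := L)
    (φ := L z) (C := ε) (x := !₂[0, x 1]) (y := x)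
    (fun y hy => (hφ.hasFDerivWithinAt i hy.1).mono Set.inter_subset_left)
    (fun y hy => by rw [← dist_eq_norm]; exact (hLr hy.1 hy.2).le)
    ⟨by simp [closedHalfPlane], hxb'⟩ ⟨hxs, hxb⟩
  have e1 : x - !₂[0, x 1] = x 0 • !₂[1, 0] := plane_ext (by simp) (by simp)
  have e2 : ‖(!₂[1, 0] : Plane)‖ = 1 := by
    simp [EuclideanSpace.norm_eq, Fin.sum_univ_two]
  rw [e1, map_smul, smul_eq_mul, norm_smul, e2, mul_one, ← hgrad, Real.norm_eq_abs,
    Real.norm_eq_abs, ← i.abs_sign_mul (x 0), abs_of_nonneg hxs] at key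
  have h1 := (abs_le.1 key).2
  have h2 : i.sign * sideGrad φ i z 0 * (i.sign * x 0) = x 0 * sideGrad φ i z 0 := by
    linear_combination (x 0 * sideGrad φ i z 0) * i.sign_mul_self
  simp only [ez]
  rw [add_mul, h2]
  linarith

lemma isLocalMax_of_touchesAbove {v ψ' : Plane → ℝ} {ψ : ℝ → ℝ} {p : Side → ℝ}
    (hz : z ∈ interface)
    (hψ : ∀ i, ∀ x ∈ closedHalfPlane i, ψ' x = ψ (x 1) + p i * x 0)
    (h : ∀ i, TouchesAbove v ψ i z (i.sign * p i)) : IsLocalMax (fun x => v x - ψ' x) z := by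
  have hz0 : z 0 = 0 := hz
  have hzv : ψ' z = ψ (z 1) := by
    rw [hψ Side.R z (interface_subset_closedHalfPlane _ hz), hz0]; ring
  have key : ∀ (i : Side) (x : Plane), 0 ≤ i.sign * x 0 →
      v x - ψ (x 1) - i.sign * p i * (i.sign * x 0) ≤ v z - ψ (z 1) →
      v x - ψ' x ≤ v z - ψ' z := fun i x hx hle => by
    rw [hψ i x hx, hzv]
    have : i.sign * p i * (i.sign * x 0) = p i * x 0 := by
      linear_combination (p i * x 0) * i.sign_mul_self
    linarith
  filter_upwards [h Side.L, h Side.R] with x hL hR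
  rcases le_total 0 (x 0) with h0 | h0
  · have : 0 ≤ Side.R.sign * x 0 := by simp only [Side.sign]; linarith
    exact key Side.R x this (hR this)
  · have : 0 ≤ Side.L.sign * x 0 := by simp only [Side.sign]; linarith
    exact key Side.L x this (hL this)

/-- The element of `R^Π(z̄)` defined by `ψ`. -/
noncomputable def reducedFunction (P : Side → ℝ → ℝ → ℝ) (zbar : Plane) (ψ : ℝ → ℝ) (z : Plane) : ℝ :=
  ψ (z 1) +
    ((halfPlane Side.R).indicator (fun _ => P Side.R (zbar 1) (deriv ψ (zbar 1))) z +
      (halfPlane Side.L).indicator (fun _ => P Side.L (zbar 1) (deriv ψ (zbar 1))) z) * z 0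

lemma reducedFunction_eq (P : Side → ℝ → ℝ → ℝ) (zbar : Plane) (ψ : ℝ → ℝ) (i : Side)
    {x : Plane} (hx : x ∈ closedHalfPlane i) :
    reducedFunction P zbar ψ x = ψ (x 1) + P i (zbar 1) (deriv ψ (zbar 1)) * x 0 := by
  have hx' : 0 ≤ i.sign * x 0 := hx
  unfold reducedFunction
  rcases hx'.eq_or_lt with h | h
  · have : x 0 = 0 := by
      have := i.sign_mul_sign_mul (x 0)
      rw [← h, mul_zero] at this
      exact this.symm
    simp [this]
  · cases i
    · have hL : x ∈ halfPlane Side.L := h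
      have hR : x ∉ halfPlane Side.R := fun hR => by
        simp only [halfPlane, Side.sign, Set.mem_ofPred_eq] at hL hR
        linarith
      simp [hL, hR]
    · have hR : x ∈ halfPlane Side.R := h
      have hL : x ∉ halfPlane Side.L := fun hL => by
        simp only [halfPlane, Side.sign, Set.mem_ofPred_eq] at hL hR
        linarith
      simp [hL, hR]

lemma closedHalfPlane_union : closedHalfPlane Side.L ∪ closedHalfPlane Side.R = Set.univ := by
  refine Set.eq_univ_of_forall fun x => ?_
  rcases le_total 0 (x 0) with h | h
  · right; simpa [closedHalfPlane, Side.sign] using h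
  · left; simpa [closedHalfPlane, Side.sign] using h

lemma isClosed_closedHalfPlane (i : Side) : IsClosed (closedHalfPlane i) :=
  isClosed_le continuous_const (continuous_const.mul (continuous_coord 0))

lemma contDiff_affine {ψ : ℝ → ℝ} (hψ : ContDiff ℝ 1 ψ) (p : ℝ) :
    ContDiff ℝ 1 fun x : Plane => ψ (x 1) + p * x 0 :=
  (hψ.comp (EuclideanSpace.proj (𝕜 := ℝ) (1 : Fin 2)).contDiff).add
    (contDiff_const.mul (EuclideanSpace.proj (𝕜 := ℝ) (0 : Fin 2)).contDiff)

lemma isTestFunction_reducedFunction (P : Side → ℝ → ℝ → ℝ) (zbar : Plane) {ψ : ℝ → ℝ}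
    (hψ : ContDiff ℝ 1 ψ) : IsTestFunction (reducedFunction P zbar ψ) := by
  have hC : ∀ i, ContDiffOn ℝ 1 (reducedFunction P zbar ψ) (closedHalfPlane i) := fun i =>
    (contDiff_affine hψ _).contDiffOn.congr fun x hx => reducedFunction_eq P zbar ψ i hx
  refine ⟨?_, hC⟩
  rw [← continuousOn_univ, ← closedHalfPlane_union]
  exact (hC _).continuousOn.union_of_isClosed (hC _).continuousOn (isClosed_closedHalfPlane _)
    (isClosed_closedHalfPlane _)

lemma mem_reducedTestFunctions_iff {P : Side → ℝ → ℝ → ℝ} {zbar : Plane} :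
    φ ∈ reducedTestFunctions P zbar ↔ ∃ ψ, ContDiff ℝ 1 ψ ∧ φ = reducedFunction P zbar ψ := by
  constructor
  · rintro ⟨-, ψ, hψ, h⟩
    exact ⟨ψ, hψ, funext h⟩
  · rintro ⟨ψ, hψ, rfl⟩
    exact ⟨(isTestFunction_reducedFunction P zbar hψ).1, ψ, hψ, fun _ => rfl⟩

lemma sideGrad_reducedFunction (P : Side → ℝ → ℝ → ℝ) {ψ : ℝ → ℝ} (hψ : ContDiff ℝ 1 ψ)
    (hz : z ∈ interface) (i : Side) : sideGrad (reducedFunction P z ψ) i z =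
      !₂[P i (z 1) (deriv ψ (z 1)), deriv ψ (z 1)] := by
  have hzi := interface_subset_closedHalfPlane i hz
  have hd := (contDiff_affine hψ (P i (z 1) (deriv ψ (z 1)))).differentiable (by norm_num) z
  have h1 := hd.hasFDerivAt.hasFDerivWithinAt (s := closedHalfPlane i)
  have h2 := h1.congr (fun x hx => reducedFunction_eq P z ψ i hx) (reducedFunction_eq P z ψ i hzi)
  rw [sideGrad_eq_of_hasFDerivWithinAt h2 hzi, ← sideGrad_eq_of_hasFDerivWithinAt h1 hzi]
  refine sideGrad_eq_of_hasDerivAt hd hzi ?_ ?_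
  · have := ((hasDerivAt_id (z 0)).const_mul (P i (z 1) (deriv ψ (z 1)))).const_add (ψ (z 1))
    simpa using this
  · have := ((hψ.differentiable (by norm_num) (z 1)).hasDerivAt).add_const
      (P i (z 1) (deriv ψ (z 1)) * z 0)
    simpa using this

lemma tangentialDeriv_reducedFunction (P : Side → ℝ → ℝ → ℝ) {ψ : ℝ → ℝ} (hψ : ContDiff ℝ 1 ψ)
    (hz : z ∈ interface) : tangentialDeriv (reducedFunction P z ψ) z = deriv ψ (z 1) := by
  rw [tangentialDeriv_eq hz, (isTestFunction_reducedFunction P z hψ).deriv_trace hz Side.R,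
    sideGrad_reducedFunction P hψ hz]
  simp

end TestFunctions

/-! ### From reduced test functions to all test functions. -/

namespace ControlData

variable {A : Type*} {D : ControlData A} {u φ : Plane → ℝ} {z : Plane}

lemma IsSubsolutionOff.isSeparableSubsolution (hu : D.IsSubsolutionOff u) (i : Side) :
    IsSeparableSubsolution u (D.H i) D.discount i := fun x hx a b ha hb hmax => by
  have h := hu.2 i x hx _ (.of_contDiff (contDiff_separable ha hb)) hmax
  rwa [sideGrad_separable ha hb (halfPlane_subset_closedHalfPlane i hx)] at h

/-- Through `-u` and the Hamiltonian `-H^i(x, -p)`, the boundary limit at a critical slope also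
serves supersolutions. -/
lemma IsSupersolutionOff.isSeparableSubsolution_neg (hu : D.IsSupersolutionOff u) (i : Side) :
    IsSeparableSubsolution (fun x => -u x) (fun x p => -D.H i x (-p)) D.discount i :=
  fun x hx a b ha hb hmax => by
  have hx' := halfPlane_subset_closedHalfPlane i hx
  have ht := IsTestFunction.of_contDiff (contDiff_separable ha hb)
  have h := hu.2 i x hx _ ht.neg (by
    have := hmax.neg
    simpa [sub_eq_add_neg, add_comm] using this)
  rw [ht.sideGrad_neg hx', sideGrad_separable ha hb hx'] at h
  linarith

lemma transmission_reducedFunction (P : Side → ℝ → ℝ → ℝ) {ψ : ℝ → ℝ} (hψ : ContDiff ℝ 1 ψ)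
    (hz : z ∈ interface) : D.transmission u (reducedFunction P z ψ) z = D.discount * u z +
      max (D.E (z 1) (deriv ψ (z 1)))
        (D.Hinterface z !₂[P Side.L (z 1) (deriv ψ (z 1)), deriv ψ (z 1)]
          !₂[P Side.R (z 1) (deriv ψ (z 1)), deriv ψ (z 1)]) := by
  rw [transmission, tangentialDeriv_reducedFunction P hψ hz, sideGrad_reducedFunction P hψ hz,
    sideGrad_reducedFunction P hψ hz]

namespace StandingAssumptions

variable [MetricSpace A] (hD : D.StandingAssumptions)
include hD

/-- A control entering `Ω^i` strictly gives an inequality on `Γ` for subsolutions in `Ω^i`. -/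
lemma control_le_zero (hu : D.IsSubsolutionOff u) (hjump : NoJumpOnInterface u)
    (hz : z ∈ interface) {i : Side} {ψ : ℝ → ℝ} (hψ : ContDiff ℝ 1 ψ) {s : ℝ}
    (ht : TouchesAbove u ψ i z s) {a : A} (ha : a ∈ D.ctrl i) (hpos : 0 < i.sign * D.f i z a 0) :
    D.discount * u z + (-(inner ℝ !₂[i.sign * s, deriv ψ (z 1)] (D.f i z a)) - D.cost i z a) ≤ 0 := by
  have hf := hD.continuous_f_left i ha
  have hl := hD.continuous_cost_left i ha
  have hsub : IsSeparableSubsolution u (fun x p => -(inner ℝ p (D.f i x a)) - D.cost i x a)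
      D.discount i := fun x hx b c hb hc hmax => by
    have h1 := hu.isSeparableSubsolution i x hx b c hb hc hmax
    have h2 := hD.le_H i x !₂[deriv b (x 0), deriv c (x 1)] ha
    linarith
  refine le_zero_of_touchesAbove hD.discount_pos.le hz hu.1 hψ ?_ ?_ hsub ht (hjump i z hz)
  · refine Continuous.continuousAt ?_
    have h1 : Continuous fun q : Plane × Plane => D.f i q.1 a := hf.comp continuous_fst
    exact (continuous_snd.inner h1).neg.sub (hl.comp continuous_fst)
  · have hc : Continuous fun x => i.sign * D.f i x a 0 :=
      continuous_const.mul ((continuous_coord 0).comp hf)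
    filter_upwards [(hc.tendsto z).eventually (lt_mem_nhds hpos)] with x hx p q h1 h0
    rw [inner_plane, inner_plane, h1]
    have h := mul_le_mul_of_nonneg_right h0 hx.le
    have e : ∀ t : ℝ, i.sign * t * (i.sign * D.f i x a 0) = t * D.f i x a 0 := fun t => by
      linear_combination (t * D.f i x a 0) * i.sign_mul_self
    rw [e, e] at h
    linarith

/-- A control tangent at `z` may point out of `Ω^i` at nearby points, which would spoil the
monotonicity in the slope. It is mixed with a small proportion `θ` of a strictly entering control,
and `θ → 0`. -/
lemma Hplus_le_zero_of_touchesAbove (hu : D.IsSubsolutionOff u) (hjump : NoJumpOnInterface u)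
    (hz : z ∈ interface) {i : Side} {ψ : ℝ → ℝ} (hψ : ContDiff ℝ 1 ψ) {s : ℝ}
    (ht : TouchesAbove u ψ i z s) :
    D.discount * u z + D.Hplus i z !₂[i.sign * s, deriv ψ (z 1)] ≤ 0 := by
  obtain ⟨δ, hδ, hδa⟩ := hD.exists_control_normal
  obtain ⟨b, hb, eb⟩ := hδa i z hz (i.sign * δ) (by rw [i.abs_sign_mul, abs_of_pos hδ])
  have hle : D.Hplus i z !₂[i.sign * s, deriv ψ (z 1)] ≤ -(D.discount * u z) := by
    refine controlHam_le (hD.plus_nonempty hz i) fun a ha => ?_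
    set p : Plane := !₂[i.sign * s, deriv ψ (z 1)] with hp
    set α := -(inner ℝ p (D.f i z a)) - D.cost i z a with hα
    set β := -(inner ℝ p (D.f i z b)) - D.cost i z b with hβ
    have hmix : ∀ θ ∈ Set.Ioc (0 : ℝ) 1, (1 - θ) * α + θ * β ≤ -(D.discount * u z) := fun θ hθ => by
      obtain ⟨c, hc, fc, lc⟩ := hD.exists_convex_combination (z := z) ha.1 hb hθ.1.le hθ.2
      have hcpos : 0 < i.sign * D.f i z c 0 := by
        have e : i.sign * D.f i z c 0 = (1 - θ) * (i.sign * D.f i z a 0) + θ * δ := by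
          rw [fc, eb]
          simp only [PiLp.add_apply, PiLp.smul_apply, smul_eq_mul, Matrix.cons_val_zero]
          linear_combination (θ * δ) * i.sign_mul_self
        rw [e]
        have h1 := mul_nonneg (sub_nonneg.2 hθ.2) ha.2
        have h2 := mul_pos hθ.1 hδ
        linarith
      have h := hD.control_le_zero hu hjump hz hψ ht hc hcpos
      rw [fc, lc, inner_add_right, inner_smul_right, inner_smul_right, ← hp] at h
      simp only [hα, hβ]
      linarith
    have hlim : Tendsto (fun θ : ℝ => (1 - θ) * α + θ * β) (𝓝[>] 0) (𝓝 α) := by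
      have : Continuous fun θ : ℝ => (1 - θ) * α + θ * β := by fun_prop
      simpa using (this.tendsto 0).mono_left nhdsWithin_le_nhds
    refine le_of_tendsto hlim ?_
    filter_upwards [Ioc_mem_nhdsGT (zero_lt_one' ℝ)] with θ hθ using hmix θ hθ
  linarith

/-- A subsolution in `Ω^i` that does not jump on `Γ` satisfies the part of the transmission
condition that involves `H^{+,i}`. -/
lemma Hplus_le_zero (hu : D.IsSubsolutionOff u) (hjump : NoJumpOnInterface u) (hz : z ∈ interface)
    (hφ : IsTestFunction φ) (hmax : IsLocalMax (fun x => u x - φ x) z) (i : Side) :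
    D.discount * u z + D.Hplus i z (sideGrad φ i z) ≤ 0 := by
  have hcont : Continuous fun ε : ℝ => D.discount * u z + D.Hplus i z
      !₂[i.sign * (i.sign * sideGrad φ i z 0 + ε), deriv (fun t : ℝ => φ !₂[0, t]) (z 1)] :=
    continuous_const.add ((hD.continuous_Hplus hz i).comp (by fun_prop))
  have hlim := (hcont.tendsto 0).mono_left (nhdsWithin_le_nhds (s := Set.Ioi 0))
  have e : (!₂[i.sign * (i.sign * sideGrad φ i z 0 + 0),
      deriv (fun t : ℝ => φ !₂[0, t]) (z 1)] : Plane) = sideGrad φ i z :=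
    plane_ext (by simp [i.sign_mul_sign_mul]) (by simpa using hφ.deriv_trace hz i)
  rw [e] at hlim
  refine le_of_tendsto hlim ?_
  filter_upwards [self_mem_nhdsWithin] with ε hε
  exact hD.Hplus_le_zero_of_touchesAbove hu hjump hz hφ.contDiff_trace
    (hφ.touchesAbove hz hmax i hε)

/-- The no-jump condition is used only for `H_Γ`. For `E`, if slope `Π^i` does not touch, the
critical slope is beyond it, where `H^i ≥ H^{-,i} ≥ E`. -/
theorem isSubsolutionOn_of_reduced {P : Side → ℝ → ℝ → ℝ} (hP : D.IsSlopeSelection P)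
    (hu : D.IsSubsolutionOff u) (hjump : NoJumpOnInterface u)
    (hred : ∀ z ∈ interface, ∀ φ ∈ reducedTestFunctions P z,
      IsLocalMax (fun x => u x - φ x) z → D.transmission u φ z ≤ 0) : D.IsSubsolutionOn u := by
  refine ⟨hu.1, fun z hz φ hφ hmax => ?_⟩
  set ψ : ℝ → ℝ := fun t => φ !₂[0, t] with hψdef
  have hψ : ContDiff ℝ 1 ψ := hφ.contDiff_trace
  have hplus := hD.Hplus_le_zero hu hjump hz hφ hmax
  have hE : D.discount * u z + D.E (z 1) (deriv ψ (z 1)) ≤ 0 := by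
    by_contra! hE
    have htouch : ∀ i, TouchesAbove u ψ i z (i.sign * P i (z 1) (deriv ψ (z 1))) := fun i => by
      by_contra hnot
      obtain ⟨c, hc, -, hup, hdown⟩ :=
        exists_critical_slope (hφ.touchesAbove hz hmax i one_pos) hnot
      have h := le_zero_of_critical_slope hD.discount_pos.le hz hu.1 hψ
        (hD.continuous_H i).continuousAt (hu.isSeparableSubsolution i) hup hdown
      have h1 := hD.E_le_Hminus hP i hz (deriv ψ (z 1)) hc
      have h2 := (le_max_right _ _).trans_eq
        (hD.H_eq_max hz i !₂[i.sign * c, deriv ψ (z 1)]).symm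
      linarith
    have hloc := isLocalMax_of_touchesAbove hz
      (fun i x hx => reducedFunction_eq P z ψ i hx) htouch
    have h := hred z hz _ (mem_reducedTestFunctions_iff.2 ⟨ψ, hψ, rfl⟩) hloc
    rw [transmission_reducedFunction P hψ hz] at h
    have := le_max_left (D.E (z 1) (deriv ψ (z 1)))
      (D.Hinterface z !₂[P Side.L (z 1) (deriv ψ (z 1)), deriv ψ (z 1)]
          !₂[P Side.R (z 1) (deriv ψ (z 1)), deriv ψ (z 1)])
    linarith
  rw [transmission, tangentialDeriv_eq hz, Hinterface, ← max_add_add_left, ← max_add_add_left]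
  exact max_le hE (max_le (hplus _) (hplus _))

theorem isSupersolutionOn_of_reduced {P : Side → ℝ → ℝ → ℝ} (hP : D.IsSlopeSelection P)
    (hu : D.IsSupersolutionOff u)
    (hred : ∀ z ∈ interface, ∀ φ ∈ reducedTestFunctions P z,
      IsLocalMin (fun x => u x - φ x) z → 0 ≤ D.transmission u φ z) : D.IsSupersolutionOn u := by
  refine ⟨hu.1, fun z hz φ hφ hmin => ?_⟩
  by_contra! hneg
  set ψ : ℝ → ℝ := fun t => φ !₂[0, t] with hψdef
  have hψ : ContDiff ℝ 1 ψ := hφ.contDiff_trace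
  have hψn : ContDiff ℝ 1 fun t => -ψ t := hψ.neg
  rw [transmission, tangentialDeriv_eq hz, Hinterface, ← max_add_add_left, ← max_add_add_left,
    max_lt_iff, max_lt_iff] at hneg
  obtain ⟨hE, hHL, hHR⟩ := hneg
  have hH : ∀ i, D.discount * u z + D.Hplus i z (sideGrad φ i z) < 0 := by
    rintro (_ | _)
    · exact hHL
    · exact hHR
  have hmax : IsLocalMax (fun x => -u x - -φ x) z := by
    have := hmin.neg
    simpa [sub_eq_add_neg, add_comm] using this
  have hderiv : deriv (fun t => -ψ t) (z 1) = -deriv ψ (z 1) := deriv.fun_neg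
  have htouch : ∀ i, TouchesAbove (fun x => -u x) (fun t => -ψ t) i z
      (i.sign * -P i (z 1) (deriv ψ (z 1))) := fun i => by
    have hzi := interface_subset_closedHalfPlane i hz
    by_contra hnot
    have htφ : ∀ ε > 0, TouchesAbove (fun x => -u x) (fun t => -ψ t) i z
        (-(i.sign * sideGrad φ i z 0) + ε) := fun ε hε => by
      have h := hφ.neg.touchesAbove hz hmax i hε
      rw [hφ.sideGrad_neg hzi] at h
      simpa using h
    obtain ⟨c, hc, hcle, hup, hdown⟩ := exists_critical_slope (htφ 1 one_pos) hnot
    -- `φ` gives touching slopes arbitrarily close to its own, so `-c` is at least the slope of `φ`;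
    -- as it is also at most that of `Π^i`, both `H^{+,i}` and `H^{-,i}` stay below `-λu(z)` at
    -- `-c`.
    have hcφ : c ≤ -(i.sign * sideGrad φ i z 0) :=
      le_of_forall_pos_le_add fun ε hε => hcle _ (htφ ε hε)
    have hF : Continuous fun q : Plane × Plane => -D.H i q.1 (-q.2) :=
      ((hD.continuous_H i).comp
        (f := fun q : Plane × Plane => (q.1, -q.2)) (by fun_prop)).neg
    have h := le_zero_of_critical_slope hD.discount_pos.le hz
      (v := fun x => -u x) (F := fun x p => -D.H i x (-p))
      hu.1.neg hψn hF.continuousAt (hu.isSeparableSubsolution_neg i) hup hdown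
    have e : -(!₂[i.sign * c, deriv (fun t => -ψ t) (z 1)] : Plane) =
        !₂[i.sign * -c, deriv ψ (z 1)] := plane_ext (by simp) (by simp [hderiv])
    rw [e, hD.H_eq_max hz] at h
    have h1 := hD.Hminus_le_E hP i hz (deriv ψ (z 1)) (s := -c) (by
      rw [mul_neg] at hc; linarith)
    have h2 : D.Hplus i z !₂[i.sign * -c, deriv ψ (z 1)] ≤ D.Hplus i z (sideGrad φ i z) := by
      refine hD.Hplus_le_of_le hz ?_ (hφ.deriv_trace hz i).symm
      simp only [Matrix.cons_val_zero, i.sign_mul_sign_mul]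
      linarith
    have h3 := hH i
    have h4 : max (D.Hplus i z !₂[i.sign * -c, deriv ψ (z 1)])
        (D.Hminus i z !₂[i.sign * -c, deriv ψ (z 1)]) < -(D.discount * u z) :=
      max_lt (by linarith) (by linarith)
    linarith
  have hloc := isLocalMax_of_touchesAbove (ψ' := fun x => -reducedFunction P z ψ x) hz
    (p := fun i => -P i (z 1) (deriv ψ (z 1)))
    (fun i x hx => by rw [reducedFunction_eq P z ψ i hx]; ring) htouch
  have hloc' : IsLocalMin (fun x => u x - reducedFunction P z ψ x) z := by
    have := hloc.neg
    simpa [sub_eq_add_neg, add_comm] using this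
  have h := hred z hz _ (mem_reducedTestFunctions_iff.2 ⟨ψ, hψ, rfl⟩) hloc'
  rw [transmission_reducedFunction P hψ hz, Hinterface] at h
  have hL := hD.Hplus_le_E hP Side.L hz (deriv ψ (z 1))
  have hR := hD.Hplus_le_E hP Side.R hz (deriv ψ (z 1))
  rw [max_eq_left (max_le hL hR)] at h
  linarith

end StandingAssumptions
end ControlData

lemma isTestFunction_of_mem_reducedTestFunctions {P : Side → ℝ → ℝ → ℝ} {zbar : Plane}
    {φ : Plane → ℝ} (h : φ ∈ reducedTestFunctions P zbar) : IsTestFunction φ := by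
  obtain ⟨ψ, hψ, rfl⟩ := mem_reducedTestFunctions_iff.1 h
  exact isTestFunction_reducedFunction P zbar hψ

end Interface

theorem mainTheorem8 {A : Type*} [MetricSpace A] (D : Interface.ControlData A)
    (hD : D.StandingAssumptions) (P : Interface.Side → ℝ → ℝ → ℝ) (hP : D.IsSlopeSelection P)
    (u : Interface.Plane → ℝ) :
    (D.IsSubsolutionOff u →
      (D.IsSubsolutionOn u →
        ∀ z ∈ Interface.interface, ∀ φ ∈ Interface.reducedTestFunctions P z,
          IsLocalMax (fun x => u x - φ x) z → D.transmission u φ z ≤ 0) ∧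
      (Interface.NoJumpOnInterface u →
        (∀ z ∈ Interface.interface, ∀ φ ∈ Interface.reducedTestFunctions P z,
          IsLocalMax (fun x => u x - φ x) z → D.transmission u φ z ≤ 0) →
        D.IsSubsolutionOn u)) ∧
    (D.IsSupersolutionOff u →
      (D.IsSupersolutionOn u ↔
        ∀ z ∈ Interface.interface, ∀ φ ∈ Interface.reducedTestFunctions P z,
          IsLocalMin (fun x => u x - φ x) z → 0 ≤ D.transmission u φ z)) := by
  refine ⟨fun hu => ⟨fun hon z hz φ hφ hmax => ?_, hD.isSubsolutionOn_of_reduced hP hu⟩,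
    fun hu => ⟨fun hon z hz φ hφ hmin => ?_, hD.isSupersolutionOn_of_reduced hP hu⟩⟩
  · exact hon.2 z hz φ (Interface.isTestFunction_of_mem_reducedTestFunctions hφ) hmax
  · exact hon.2 z hz φ (Interface.isTestFunction_of_mem_reducedTestFunctions hφ) hmin
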